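/- **Setting.** Let $\mathbf a,\mathbf a^\dagger,\mathbf b,\mathbf b^\dagger$ be the annihilation and creation operators of two bosonic modes on the Fock space $\mathcal F=\ell^2(\mathbb N\times\mathbb N)$ (number representation), and write $\mathbb O=(\mathbf a,\mathbf a^\dagger,\mathbf b,\mathbf b^\dagger)^{T}$, $\mathbb E=\mathrm{diag}(1,-1,1,-1)$. A phase-space point $(z_a,z_b)\in\mathbb C^2$ is identified with the column $(z_a,z_a^*,z_b,z_b^*)^T$; let $\mathbb G,\mathbb X$ be the columns of $(\xi_a,\xi_b)$ and $(\alpha_a,\alpha_b)$. For a density operator $\boldsymbol\rho$ (positive, trace one) put $$\mathbf D(\mathbb G)=\exp(-\mathbb G^\dagger\mathbb E\mathbb O),\qquad \mathscr C_{\boldsymbol\rho}(\mathbb G)=\mathrm{Tr}[\mathbf D(\mathbb G)\boldsymbol\rho],\qquad \mathscr W_{\boldsymbol\rho}(\mathbb X)=\int\frac{d^2\xi_a\,d^2\xi_b}{\pi^2}\,e^{\mathbb G^\dagger\mathbb E\mathbb X}\,\mathscr C_{\boldsymbol\rho}(\mathbb G).$$ Let $\mathbf U(t)$ be unitary operators on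 $\mathcal F$ and let $$\mathbb T(t)=\begin{pmatrix}\mu_a&\nu_a&\chi_a&\eta_a\\ \nu_a^*&\mu_a^*&\eta_a^*&\chi_a^*\\ \mu_b&\nu_b&\chi_b&\eta_b\\ \nu_b^*&\mu_b^*&\eta_b^*&\chi_b^*\end{pmatrix}$$ with complex functions $\mu_a,\dots,\eta_b$ of $t$. Say that $\mathbf U(t)$ *acts linearly through* $\mathbb T(t)$ if $\mathbf U^\dagger(t)\,\mathbb O\,\mathbf U(t)=\mathbb T(t)\,\mathbb O$ on the finite linear combinations of number states. **Theorem.** (1) Suppose that $\mathbf U(t)$, $\mathbf U(0)=\mathbf 1$, is the time-evolution operator, for $t\ge 0$, of a quadratic Hamiltonian $\mathbf H(t)=\sum_{j,k}h_{jk}(t)\,\mathbb O_j^\dagger\mathbb O_k$ with $h(t)$ Hermitian (the space of vectors with rapidly decreasing number amplitudes is preserved, and on it $\mathrm i\,\frac{d}{dt}\mathbf U(t)\psi=\mathbf H(t)\mathbf U(t)\psi$ in the topology of that space), and that $\mathbb T(t)$ solves the Heisenberg equations: $\mathbb T(0)=1$ and $\dot{\mathbb T}(t)=C(t)\mathbb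 T(t)$, where $\mathrm i[\mathbf H(t),\mathbb O_j]=\sum_k C_{jk}(t)\mathbb O_k$. Then $\mathbf U(t)$ acts linearly through $\mathbb T(t)$ for all $t\ge0$. (2) Suppose that $\mathbf U(t)$ acts linearly through $\mathbb T(t)$ for all $t\ge 0$. Then, for every $t\ge0$, $\mathbb T(t)$ is invertible, and $\mathbb Z=\mathbb T^{-1}(t)\mathbb X$ is the column of the phase-space point $(\gamma_a,\gamma_b)$ with $$\gamma_a=\mu_a^*\alpha_a-\nu_a\alpha_a^*+\mu_b^*\alpha_b-\nu_b\alpha_b^*,\qquad \gamma_b=\chi_a^*\alpha_a-\eta_a\alpha_a^*+\chi_b^*\alpha_b-\eta_b\alpha_b^* .$$ If $\boldsymbol\rho(0)$ is a density operator, $\boldsymbol\rho(t)=\mathbf U(t)\boldsymbol\rho(0)\mathbf U^\dagger(t)$, $\mathscr C(\,\cdot\,;t)=\mathscr C_{\boldsymbol\rho(t)}$ and $\mathscr W(\,\cdot\,;t)=\mathscr W_{\boldsymbol\rho(t)}$, then $\mathscr C(\,\cdot\,;t)$ is integrable if and only if $\mathscr C(\,\cdot\,;0)$ is, and $$\mathscr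 W(\mathbb X;t)=\mathscr W(\mathbb Z;0),\qquad \mathbb Z=\mathbb T^{-1}(t)\mathbb X .$$ For every density operator, also when $\mathscr C$ is not integrable and $\mathscr W$ is its Fourier transform as a tempered distribution, the identity holds in the form $\int\mathscr W(\mathbb X;t)f(\mathbb X)\,d^2\alpha_a d^2\alpha_b=\int\mathscr W(\mathbb Z;0)f(\mathbb T(t)\mathbb Z)\,d^2\gamma_a d^2\gamma_b$ for all Schwartz functions $f$. -/

import Mathlib

open scoped Nat ComplexConjugate Matrix

namespace TwoMode

/-! ## The two-mode Fock space in the number representation -/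

/-- Number-state amplitudes `f (m, n) = ⟨m, n | f⟩`, with no condition of summability. -/
abbrev Amp : Type := ℕ × ℕ → ℂ

/-- The Hilbert space of the two modes: square-summable amplitudes. -/
abbrev Fock : Type := lp (fun _ : ℕ × ℕ => ℂ) 2

/-- The number state `|m, n⟩`. -/
noncomputable def numberState (p : ℕ × ℕ) : Fock := lp.single 2 p 1

open Classical in
/-- A square-summable amplitude as a vector of the Fock space (and `0` otherwise). -/
noncomputable def toFock (f : Amp) : Fock := if h : Memℓp f 2 then ⟨f, h⟩ else 0

/-- Finite linear combinations of number states. -/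
def IsFinite (f : Amp) : Prop := f.support.Finite

/-- The annihilation operator `a`: `(a f)(m, n) = √(m+1) f (m+1, n)`. -/
noncomputable def annihA : Module.End ℂ Amp where
  toFun f p := (√((p.1 : ℝ) + 1) : ℝ) * f (p.1 + 1, p.2)
  map_add' f g := by ext p; simp [mul_add]
  map_smul' c f := by ext p; simp [mul_left_comm]

/-- The creation operator `a†`: `(a† f)(m, n) = √m f (m-1, n)`, which is `0` for `m = 0`. -/
noncomputable def creatA : Module.End ℂ Amp where
  toFun f p := (√(p.1 : ℝ) : ℝ) * f (p.1 - 1, p.2)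
  map_add' f g := by ext p; simp [mul_add]
  map_smul' c f := by ext p; simp [mul_left_comm]

/-- The annihilation operator `b` of the second mode. -/
noncomputable def annihB : Module.End ℂ Amp where
  toFun f p := (√((p.2 : ℝ) + 1) : ℝ) * f (p.1, p.2 + 1)
  map_add' f g := by ext p; simp [mul_add]
  map_smul' c f := by ext p; simp [mul_left_comm]

/-- The creation operator `b†` of the second mode. -/
noncomputable def creatB : Module.End ℂ Amp where
  toFun f p := (√(p.2 : ℝ) : ℝ) * f (p.1, p.2 - 1)
  map_add' f g := by ext p; simp [mul_add]
  map_smul' c f := by ext p; simp [mul_left_comm]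

/-- The column `𝕆 = (a, a†, b, b†)`. -/
noncomputable def ladder : Fin 4 → Module.End ℂ Amp := ![annihA, creatA, annihB, creatB]

/-- The row `𝕆† = (a†, a, b†, b)`. -/
noncomputable def ladderDag : Fin 4 → Module.End ℂ Amp := ![creatA, annihA, creatB, annihB]

/-! ## Displacement operators -/

/-- The column `(z_a, z_a*, z_b, z_b*)` of a phase-space point `(z_a, z_b)`. -/
noncomputable def phaseVec (z : ℂ × ℂ) : Fin 4 → ℂ := ![z.1, conj z.1, z.2, conj z.2]

/-- The matrix `𝔼 = diag(1, 1) ⊗ diag(1, -1)`. -/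
def signMat : Matrix (Fin 4) (Fin 4) ℂ := Matrix.diagonal ![1, -1, 1, -1]

/-- The operator `-𝔾† 𝔼 𝕆` for `𝔾 = (ξ_a, ξ_a*, ξ_b, ξ_b*)`. -/
noncomputable def dispGen (ξ : ℂ × ℂ) : Module.End ℂ Amp :=
  -∑ j, (star (phaseVec ξ) ᵥ* signMat) j • ladder j

theorem dispGen_eq (ξ : ℂ × ℂ) :
    dispGen ξ = ξ.1 • creatA - conj ξ.1 • annihA + ξ.2 • creatB - conj ξ.2 • annihB := by
  simp only [dispGen, signMat, Matrix.vecMul_diagonal, Fin.sum_univ_four, phaseVec, ladder]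
  simp
  module

/-- `V` is the exponential of `A`: on every finite combination of number states it is the sum of
the exponential series. -/
def IsExpOf (A : Module.End ℂ Amp) (V : Fock →L[ℂ] Fock) : Prop :=
  ∀ f : Amp, IsFinite f →
    HasSum (fun n : ℕ => ((n ! : ℂ))⁻¹ • toFock ((A ^ n) f)) (V (toFock f))

/-! ### Existence and uniqueness of the exponential of `-𝔾† 𝔼 𝕆` -/

theorem IsFinite.memℓp {f : Amp} (hf : IsFinite f) : Memℓp f 2 := by
  apply memℓp_gen
  refine summable_of_hasFiniteSupport (hf.subset fun p hp => ?_)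
  contrapose! hp
  simp at hp
  simp [hp]

theorem toFock_coe {f : Amp} (hf : Memℓp f 2) : (toFock f : Amp) = f := by
  simp [toFock, hf]

theorem toFock_apply {f : Amp} (hf : IsFinite f) (p : ℕ × ℕ) : (toFock f : Fock) p = f p := by
  rw [toFock_coe hf.memℓp]

theorem toFock_self (ψ : Fock) : toFock (ψ : Amp) = ψ := by
  have h : Memℓp (ψ : Amp) 2 := lp.memℓp ψ
  simp only [toFock, h, dif_pos]

/-- The finite combinations of number states as a space. -/
def finSub : Submodule ℂ Amp where
  carrier := {f | IsFinite f}
  zero_mem' := by simp [IsFinite]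
  add_mem' := fun {f g} hf hg => (hf.union hg).subset (Function.support_add f g)
  smul_mem' := fun c f hf => hf.subset (Function.support_const_smul_subset c f)

/-- The inclusion of the finite combinations of number states into the Fock space. -/
noncomputable def finIncl : finSub →ₗ[ℂ] Fock where
  toFun f := toFock f
  map_add' f g := by
    ext p
    have h := toFock_apply (f + g).2 p
    rw [h, lp.coeFn_add, Pi.add_apply, toFock_apply f.2, toFock_apply g.2]; rfl
  map_smul' c f := by
    ext p
    have h := toFock_apply (c • f).2 p
    rw [h, RingHom.id_apply, lp.coeFn_smul, Pi.smul_apply, toFock_apply f.2]; rfl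

theorem denseRange_finIncl : DenseRange finIncl := by
  intro ψ
  have h := lp.hasSum_single (p := 2) (by simp) ψ
  refine mem_closure_of_tendsto h (Filter.Eventually.of_forall fun s => ?_)
  rw [← LinearMap.coe_range]
  refine Submodule.sum_mem _ fun p _ => ?_
  have hs : IsFinite (Pi.single p (ψ p) : Amp) :=
    (Set.finite_singleton p).subset Pi.support_single_subset
  refine ⟨⟨Pi.single p (ψ p), hs⟩, ?_⟩
  ext q
  simp only [finIncl, LinearMap.coe_mk, AddHom.coe_mk]
  rw [toFock_apply hs, lp.coeFn_single]

theorem tsum_shift (s : ℕ × ℕ → ℕ × ℕ) (hs : Function.Injective s) (F : ℕ × ℕ → ℂ)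
    (hF : ∀ p, p ∉ Set.range s → F p = 0) : ∑' p, F (s p) = ∑' p, F p :=
  hs.tsum_eq fun p hp => by
    by_contra h
    exact hp (hF p h)

theorem inner_annihA (f g : Amp) :
    ∑' p, conj (annihA f p) * g p = ∑' p, conj (f p) * creatA g p := by
  rw [← tsum_shift (fun p => (p.1 + 1, p.2)) (fun p q h => by
    simp only [Prod.mk.injEq, add_left_inj] at h; exact Prod.ext h.1 h.2)
    (fun p => conj (f p) * creatA g p)]
  · refine tsum_congr fun p => ?_
    simp [annihA, creatA]; ring
  · rintro ⟨m, n⟩ h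
    rcases m with _ | m
    · simp [creatA]
    · exact absurd ⟨(m, n), rfl⟩ h

theorem inner_annihB (f g : Amp) :
    ∑' p, conj (annihB f p) * g p = ∑' p, conj (f p) * creatB g p := by
  rw [← tsum_shift (fun p => (p.1, p.2 + 1)) (fun p q h => by
    simp only [Prod.mk.injEq, add_left_inj] at h; exact Prod.ext h.1 h.2)
    (fun p => conj (f p) * creatB g p)]
  · refine tsum_congr fun p => ?_
    simp [annihB, creatB]; ring
  · rintro ⟨m, n⟩ h
    rcases n with _ | n
    · simp [creatB]
    · exact absurd ⟨(m, n), rfl⟩ h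

theorem inner_toFock {f g : Amp} (hf : IsFinite f) (hg : IsFinite g) :
    inner ℂ (toFock f) (toFock g) = ∑' p, conj (f p) * g p := by
  rw [lp.inner_eq_tsum]
  refine tsum_congr fun p => ?_
  rw [toFock_apply hf, toFock_apply hg, RCLike.inner_apply, mul_comm]

theorem isFinite_of_inj {f g : Amp} (hf : IsFinite f) (s : ℕ × ℕ → ℕ × ℕ)
    (hs : Function.Injective s) (h : ∀ p, g p ≠ 0 → f (s p) ≠ 0) : IsFinite g :=
  (hf.preimage hs.injOn).subset fun p hp => h p hp

theorem isFinite_annihA {f : Amp} (hf : IsFinite f) : IsFinite (annihA f) :=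
  isFinite_of_inj hf (fun p => (p.1 + 1, p.2)) (fun p q h => by
    simp only [Prod.mk.injEq, add_left_inj] at h; exact Prod.ext h.1 h.2)
    fun p hp h => hp (by simp [annihA, h])

theorem isFinite_annihB {f : Amp} (hf : IsFinite f) : IsFinite (annihB f) :=
  isFinite_of_inj hf (fun p => (p.1, p.2 + 1)) (fun p q h => by
    simp only [Prod.mk.injEq, add_left_inj] at h; exact Prod.ext h.1 h.2)
    fun p hp h => hp (by simp [annihB, h])

theorem isFinite_creatA {f : Amp} (hf : IsFinite f) : IsFinite (creatA f) := by
  refine (hf.image fun p => (p.1 + 1, p.2)).subset ?_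
  rintro ⟨m, n⟩ hp
  rcases m with _ | m
  · simp [creatA] at hp
  · exact ⟨(m, n), fun h => hp (by simp [creatA, h]), rfl⟩

theorem isFinite_creatB {f : Amp} (hf : IsFinite f) : IsFinite (creatB f) := by
  refine (hf.image fun p => (p.1, p.2 + 1)).subset ?_
  rintro ⟨m, n⟩ hp
  rcases n with _ | n
  · simp [creatB] at hp
  · exact ⟨(m, n), fun h => hp (by simp [creatB, h]), rfl⟩

theorem dispGen_mem (ξ : ℂ × ℂ) : ∀ f ∈ finSub, dispGen ξ f ∈ finSub := by
  intro f hf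
  rw [dispGen_eq]
  exact finSub.sub_mem (finSub.add_mem (finSub.sub_mem
    (finSub.smul_mem _ (isFinite_creatA hf)) (finSub.smul_mem _ (isFinite_annihA hf)))
    (finSub.smul_mem _ (isFinite_creatB hf))) (finSub.smul_mem _ (isFinite_annihB hf))

/-- The operator `-𝔾† 𝔼 𝕆` on the finite combinations of number states. -/
noncomputable def dispFin (ξ : ℂ × ℂ) : Module.End ℂ finSub :=
  (dispGen ξ).restrict (dispGen_mem ξ)

theorem dispFin_pow_coe (ξ : ℂ × ℂ) (n : ℕ) (x : finSub) :
    ((dispFin ξ ^ n) x : Amp) = (dispGen ξ ^ n) x := by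
  rw [dispFin, Module.End.pow_restrict]; rfl

/-- The four ladder operators on finite combinations of number states. -/
noncomputable def aFin : Module.End ℂ finSub := annihA.restrict fun _ h => isFinite_annihA h
/-- `a†` on finite combinations. -/
noncomputable def aDagFin : Module.End ℂ finSub := creatA.restrict fun _ h => isFinite_creatA h
/-- `b` on finite combinations. -/
noncomputable def bFin : Module.End ℂ finSub := annihB.restrict fun _ h => isFinite_annihB h
/-- `b†` on finite combinations. -/
noncomputable def bDagFin : Module.End ℂ finSub := creatB.restrict fun _ h => isFinite_creatB h

theorem dispFin_apply (ξ : ℂ × ℂ) (x : finSub) :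
    dispFin ξ x = ξ.1 • aDagFin x - conj ξ.1 • aFin x + ξ.2 • bDagFin x - conj ξ.2 • bFin x := by
  apply Subtype.ext
  change dispGen ξ x = _
  rw [dispGen_eq]; rfl

theorem inner_aFin (x y : finSub) :
    inner ℂ (finIncl (aFin x)) (finIncl y) = inner ℂ (finIncl x) (finIncl (aDagFin y)) := by
  have h1 := inner_toFock (aFin x).2 y.2
  have h2 := inner_toFock x.2 (aDagFin y).2
  exact h1.trans ((inner_annihA x y).trans h2.symm)

theorem inner_bFin (x y : finSub) :
    inner ℂ (finIncl (bFin x)) (finIncl y) = inner ℂ (finIncl x) (finIncl (bDagFin y)) := by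
  have h1 := inner_toFock (bFin x).2 y.2
  have h2 := inner_toFock x.2 (bDagFin y).2
  exact h1.trans ((inner_annihB x y).trans h2.symm)

theorem inner_aDagFin (x y : finSub) :
    inner ℂ (finIncl (aDagFin x)) (finIncl y) = inner ℂ (finIncl x) (finIncl (aFin y)) := by
  rw [← inner_conj_symm, ← inner_aFin, inner_conj_symm]

theorem inner_bDagFin (x y : finSub) :
    inner ℂ (finIncl (bDagFin x)) (finIncl y) = inner ℂ (finIncl x) (finIncl (bFin y)) := by
  rw [← inner_conj_symm, ← inner_bFin, inner_conj_symm]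

theorem inner_dispFin (ξ : ℂ × ℂ) (x y : finSub) :
    inner ℂ (finIncl (dispFin ξ x)) (finIncl y) = -inner ℂ (finIncl x) (finIncl (dispFin ξ y)) := by
  simp only [dispFin_apply, map_add, map_sub, map_smul, inner_add_left, inner_sub_left,
    inner_smul_left, inner_add_right, inner_sub_right, inner_smul_right, inner_aFin, inner_bFin,
    inner_aDagFin, inner_bDagFin, RCLike.conj_conj]
  ring

theorem inner_dispFin_pow (ξ : ℂ × ℂ) (n : ℕ) (x y : finSub) :
    inner ℂ (finIncl ((dispFin ξ ^ n) x)) (finIncl y) =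
      (-1) ^ n * inner ℂ (finIncl x) (finIncl ((dispFin ξ ^ n) y)) := by
  induction n generalizing x y with
  | zero => simp
  | succ n ih =>
    rw [pow_succ', Module.End.mul_apply, inner_dispFin, ih, ← Module.End.mul_apply, ← pow_succ,
      ← pow_succ']
    ring

/-- `x` has no component on a number state with more than `M` quanta. -/
def Below (M : ℕ) (x : finSub) : Prop := ∀ p : ℕ × ℕ, M < p.1 + p.2 → (x : Amp) p = 0

theorem exists_below (x : finSub) : ∃ M, Below M x := by
  obtain ⟨M, hM⟩ := (x.2.image fun p => p.1 + p.2).bddAbove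
  refine ⟨M, fun p hp => ?_⟩
  by_contra h
  exact absurd (hM ⟨p, h, rfl⟩) (by simpa using hp)

theorem re_inner_nonneg (x y : finSub) (d : ℕ × ℕ → ℝ)
    (hy : ∀ p, (y : Amp) p = d p * (x : Amp) p) (hd : ∀ p, (x : Amp) p ≠ 0 → 0 ≤ d p) :
    0 ≤ RCLike.re (inner ℂ (finIncl x) (finIncl y) : ℂ) := by
  have h : inner ℂ (finIncl x) (finIncl y) = ((∑' p, d p * ‖(x : Amp) p‖ ^ 2 : ℝ) : ℂ) := by
    refine (inner_toFock x.2 y.2).trans ?_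
    rw [Complex.ofReal_tsum]
    refine tsum_congr fun p => ?_
    rw [hy, mul_left_comm, Complex.conj_mul']
    push_cast; rfl
  rw [h]
  change 0 ≤ ∑' p, d p * ‖(x : Amp) p‖ ^ 2
  refine tsum_nonneg fun p => ?_
  by_cases hp : (x : Amp) p = 0
  · simp [hp]
  · exact mul_nonneg (hd p hp) (by positivity)

theorem norm_le_of_diag (S S' : Module.End ℂ finSub) (c : ℕ × ℕ → ℝ) (K : ℝ) (hK : 0 ≤ K)
    (x : finSub) (hadj : ∀ x y : finSub,
      inner ℂ (finIncl (S x)) (finIncl y) = inner ℂ (finIncl x) (finIncl (S' y)))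
    (hc : ∀ p, (S' (S x) : Amp) p = c p * (x : Amp) p)
    (hle : ∀ p, (x : Amp) p ≠ 0 → c p ≤ K) :
    ‖finIncl (S x)‖ ≤ √K * ‖finIncl x‖ := by
  have h := re_inner_nonneg x ((K : ℂ) • x - S' (S x)) (fun p => K - c p)
    (fun p => by
      change (K : ℂ) * (x : Amp) p - (S' (S x) : Amp) p = _
      rw [hc]; push_cast; ring) (fun p hp => sub_nonneg.2 (hle p hp))
  rw [map_sub, map_smul, inner_sub_right, inner_smul_right, ← hadj, inner_self_eq_norm_sq_to_K,
    inner_self_eq_norm_sq_to_K] at h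
  have h2 : ‖finIncl (S x)‖ ^ 2 ≤ K * ‖finIncl x‖ ^ 2 := by
    have e : ((K : ℂ) * ((‖finIncl x‖ : ℝ) : ℂ) ^ 2 - ((‖finIncl (S x)‖ : ℝ) : ℂ) ^ 2) =
        ((K * ‖finIncl x‖ ^ 2 - ‖finIncl (S x)‖ ^ 2 : ℝ) : ℂ) := by push_cast; rfl
    change 0 ≤ Complex.re ((K : ℂ) * ((‖finIncl x‖ : ℝ) : ℂ) ^ 2
      - ((‖finIncl (S x)‖ : ℝ) : ℂ) ^ 2) at h
    rw [e, Complex.ofReal_re] at h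
    linarith
  refine abs_le_of_sq_le_sq' ?_ (by positivity) |>.2
  rw [mul_pow, Real.sq_sqrt hK]; exact h2

theorem norm_ladder_le {M : ℕ} {x : finSub} (hx : Below M x) :
    ‖finIncl (aFin x)‖ ≤ √(M + 1) * ‖finIncl x‖ ∧ ‖finIncl (aDagFin x)‖ ≤ √(M + 1) * ‖finIncl x‖ ∧
    ‖finIncl (bFin x)‖ ≤ √(M + 1) * ‖finIncl x‖ ∧
    ‖finIncl (bDagFin x)‖ ≤ √(M + 1) * ‖finIncl x‖ := by
  have hM : ∀ p : ℕ × ℕ, (x : Amp) p ≠ 0 → (p.1 : ℝ) + p.2 ≤ M := fun p hp => by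
    have : p.1 + p.2 ≤ M := not_lt.1 fun h => hp (hx p h)
    exact_mod_cast this
  have hs : ∀ k : ℕ, ((√(k : ℝ) : ℝ) : ℂ) * ((√(k : ℝ) : ℝ) : ℂ) = (k : ℂ) := fun k => by
    rw [← Complex.ofReal_mul, Real.mul_self_sqrt (by positivity)]; simp
  have hK : (0 : ℝ) ≤ M + 1 := by positivity
  refine ⟨norm_le_of_diag aFin aDagFin (fun p => p.1) _ hK x inner_aFin ?_ ?_,
    norm_le_of_diag aDagFin aFin (fun p => p.1 + 1) _ hK x inner_aDagFin ?_ ?_,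
    norm_le_of_diag bFin bDagFin (fun p => p.2) _ hK x inner_bFin ?_ ?_,
    norm_le_of_diag bDagFin bFin (fun p => p.2 + 1) _ hK x inner_bDagFin ?_ ?_⟩
  · rintro ⟨m, n⟩
    change creatA (annihA x) (m, n) = _
    rcases m with _ | m
    · simp [creatA]
    · have := hs (m + 1)
      push_cast at this
      simp [creatA, annihA, ← mul_assoc, this]
  · intro p hp
    have := hM p hp
    have : (0 : ℝ) ≤ p.2 := by positivity
    linarith
  · rintro ⟨m, n⟩
    change annihA (creatA x) (m, n) = _
    have := hs (m + 1)
    push_cast at this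
    simp [creatA, annihA, ← mul_assoc, this]
  · intro p hp
    have := hM p hp
    have : (0 : ℝ) ≤ p.2 := by positivity
    linarith
  · rintro ⟨m, n⟩
    change creatB (annihB x) (m, n) = _
    rcases n with _ | n
    · simp [creatB]
    · have := hs (n + 1)
      push_cast at this
      simp [creatB, annihB, ← mul_assoc, this]
  · intro p hp
    have := hM p hp
    have : (0 : ℝ) ≤ p.1 := by positivity
    linarith
  · rintro ⟨m, n⟩
    change annihB (creatB x) (m, n) = _
    have := hs (n + 1)
    push_cast at this
    simp [creatB, annihB, ← mul_assoc, this]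
  · intro p hp
    have := hM p hp
    have : (0 : ℝ) ≤ p.1 := by positivity
    linarith

theorem below_dispFin (ξ : ℂ × ℂ) {M : ℕ} {x : finSub} (hx : Below M x) :
    Below (M + 1) (dispFin ξ x) := by
  rintro ⟨m, n⟩ hp
  change dispGen ξ x (m, n) = 0
  have h1 : (x : Amp) (m + 1, n) = 0 := hx _ (by simp at hp ⊢; omega)
  have h2 : (x : Amp) (m - 1, n) = 0 := hx _ (by simp at hp ⊢; omega)
  have h3 : (x : Amp) (m, n + 1) = 0 := hx _ (by simp at hp ⊢; omega)
  have h4 : (x : Amp) (m, n - 1) = 0 := hx _ (by simp at hp ⊢; omega)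
  rw [dispGen_eq]
  simp [annihA, creatA, annihB, creatB, h1, h2, h3, h4]

theorem norm_dispFin_le (ξ : ℂ × ℂ) {M : ℕ} {x : finSub} (hx : Below M x) :
    ‖finIncl (dispFin ξ x)‖ ≤ 2 * (‖ξ.1‖ + ‖ξ.2‖) * √(M + 1) * ‖finIncl x‖ := by
  obtain ⟨h1, h2, h3, h4⟩ := norm_ladder_le hx
  rw [dispFin_apply]
  simp only [map_add, map_sub, map_smul]
  refine (norm_sub_le _ _).trans ((add_le_add_left ((norm_add_le _ _).trans
    (add_le_add_left (norm_sub_le _ _) _)) _).trans ?_)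
  simp only [norm_smul, RCLike.norm_conj]
  have e1 := mul_le_mul_of_nonneg_left h1 (norm_nonneg ξ.1)
  have e2 := mul_le_mul_of_nonneg_left h2 (norm_nonneg ξ.1)
  have e3 := mul_le_mul_of_nonneg_left h3 (norm_nonneg ξ.2)
  have e4 := mul_le_mul_of_nonneg_left h4 (norm_nonneg ξ.2)
  linarith

theorem below_pow (ξ : ℂ × ℂ) {M : ℕ} {x : finSub} (hx : Below M x) (n : ℕ) :
    Below (M + n) ((dispFin ξ ^ n) x) := by
  induction n with
  | zero => simpa using hx
  | succ n ih =>
    rw [pow_succ', Module.End.mul_apply]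
    exact below_dispFin ξ ih

/-- The terms of the exponential series. -/
noncomputable def expTerm (ξ : ℂ × ℂ) (n : ℕ) (x : finSub) : Fock :=
  ((n ! : ℂ))⁻¹ • finIncl ((dispFin ξ ^ n) x)

theorem norm_expTerm_succ_le (ξ : ℂ × ℂ) {M : ℕ} {x : finSub} (hx : Below M x) (n : ℕ) :
    ‖expTerm ξ (n + 1) x‖ ≤
      2 * (‖ξ.1‖ + ‖ξ.2‖) * (√(M + n + 1) / (n + 1)) * ‖expTerm ξ n x‖ := by
  have h := norm_dispFin_le ξ (below_pow ξ hx n)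
  rw [← Module.End.mul_apply, ← pow_succ'] at h
  push_cast at h
  simp only [expTerm, norm_smul, norm_inv, Complex.norm_natCast, Nat.factorial_succ]
  push_cast
  have hp : (0 : ℝ) < n + 1 := by positivity
  have hf : (0 : ℝ) < n ! := by exact_mod_cast n.factorial_pos
  refine (mul_le_mul_of_nonneg_left h (by positivity)).trans (le_of_eq ?_)
  field_simp

theorem summable_norm_expTerm (ξ : ℂ × ℂ) (x : finSub) : Summable fun n => ‖expTerm ξ n x‖ := by
  obtain ⟨M, hx⟩ := exists_below x
  set c := 2 * (‖ξ.1‖ + ‖ξ.2‖) with hc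
  have ht : Filter.Tendsto (fun n : ℕ => c * (√(M + n + 1) / (n + 1))) Filter.atTop (nhds 0) := by
    have h0 : Filter.Tendsto (fun n : ℕ => c * √(M + 1) * (√((n : ℝ) + 1))⁻¹)
        Filter.atTop (nhds 0) := by
      rw [← mul_zero (c * √(M + 1))]
      refine Filter.Tendsto.const_mul _ ?_
      refine Filter.Tendsto.comp (g := fun y : ℝ => y⁻¹) tendsto_inv_atTop_zero ?_
      exact Real.tendsto_sqrt_atTop.comp (Filter.tendsto_atTop_add_const_right Filter.atTop (1 : ℝ)
        (tendsto_natCast_atTop_atTop (R := ℝ)))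
    refine squeeze_zero (fun n => by positivity) (fun n => ?_) h0
    rw [mul_assoc c]
    refine mul_le_mul_of_nonneg_left ?_ (show 0 ≤ c by positivity)
    have hp : (0 : ℝ) < n + 1 := by positivity
    have hq : (0 : ℝ) < √((n : ℝ) + 1) := Real.sqrt_pos.2 hp
    rw [← div_eq_mul_inv, div_le_div_iff₀ hp hq, ← Real.sqrt_mul (by positivity)]
    have : ((n : ℝ) + 1) = √(((n : ℝ) + 1) * (n + 1)) := (Real.sqrt_mul_self hp.le).symm
    conv_rhs => rw [this]
    rw [← Real.sqrt_mul (by positivity)]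
    refine Real.sqrt_le_sqrt ?_
    have hMn : (0 : ℝ) ≤ M * n := by positivity
    nlinarith
  have hev := ht.eventually (Iio_mem_nhds (show (0 : ℝ) < 1 / 2 by norm_num))
  refine summable_of_ratio_norm_eventually_le (r := 1 / 2) (by norm_num) ?_
  filter_upwards [hev] with n hn
  rw [norm_norm, norm_norm]
  exact (norm_expTerm_succ_le ξ hx n).trans
    (mul_le_mul_of_nonneg_right (le_of_lt hn) (norm_nonneg _))

theorem summable_expTerm (ξ : ℂ × ℂ) (x : finSub) : Summable fun n => expTerm ξ n x :=
  (summable_norm_expTerm ξ x).of_norm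

theorem inner_expTerm (ξ : ℂ × ℂ) (j k : ℕ) (x : finSub) :
    inner ℂ (expTerm ξ j x) (expTerm ξ k x) =
      ((-1) ^ j * ((j ! : ℂ)⁻¹ * (k ! : ℂ)⁻¹)) *
        inner ℂ (finIncl x) (finIncl ((dispFin ξ ^ (j + k)) x)) := by
  simp only [expTerm, inner_smul_left, inner_smul_right, inner_dispFin_pow, map_inv₀, map_natCast,
    pow_add, Module.End.mul_apply]
  ring

theorem sum_antidiagonal_exp (n : ℕ) :
    ∑ q ∈ Finset.HasAntidiagonal.antidiagonal n, ((-1 : ℂ) ^ q.1 * ((q.1 ! : ℂ)⁻¹ * (q.2 ! : ℂ)⁻¹)) =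
      if n = 0 then 1 else 0 := by
  have h := (Commute.all (-1 : ℂ) 1).add_pow' n
  have hf : (n ! : ℂ) ≠ 0 := by exact_mod_cast n.factorial_ne_zero
  have h2 : (n ! : ℂ) * ∑ q ∈ Finset.HasAntidiagonal.antidiagonal n,
      ((-1 : ℂ) ^ q.1 * ((q.1 ! : ℂ)⁻¹ * (q.2 ! : ℂ)⁻¹)) = (-1 + 1 : ℂ) ^ n := by
    rw [h, Finset.mul_sum]
    refine Finset.sum_congr rfl fun q hq => ?_
    rw [Finset.HasAntidiagonal.mem_antidiagonal] at hq
    subst hq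
    have := Nat.add_choose_mul_factorial_mul_factorial q.1 q.2
    have h3 : ((q.1 + q.2) ! : ℂ) = (q.1 + q.2).choose q.1 * q.1 ! * q.2 ! := by
      rw [Nat.choose_symm_add]
      exact_mod_cast this.symm
    have h4 : (q.1 ! : ℂ) ≠ 0 := by exact_mod_cast q.1.factorial_ne_zero
    have h5 : (q.2 ! : ℂ) ≠ 0 := by exact_mod_cast q.2.factorial_ne_zero
    rw [h3]
    simp only [nsmul_eq_mul, one_pow, mul_one]
    field_simp
  by_cases hn : n = 0
  · subst hn; simp
  · rw [if_neg hn]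
    rw [neg_add_cancel, zero_pow hn] at h2
    exact (mul_eq_zero.1 h2).resolve_left hf

/-- The sum of the exponential series. -/
noncomputable def expSum (ξ : ℂ × ℂ) : finSub →ₗ[ℂ] Fock where
  toFun x := ∑' n, expTerm ξ n x
  map_add' x y := by
    rw [← (summable_expTerm ξ x).tsum_add (summable_expTerm ξ y)]
    simp [expTerm]
  map_smul' c x := by
    rw [RingHom.id_apply, ← (summable_expTerm ξ x).tsum_const_smul]
    refine tsum_congr fun n => ?_
    simp [expTerm, smul_comm c]

theorem norm_tsum_of_inner {E : Type*} [NormedAddCommGroup E] [InnerProductSpace ℂ E]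
    [CompleteSpace E] (v : ℕ → E) (hv : Summable fun n => ‖v n‖) (m : ℕ → ℂ)
    (hm : ∀ j k, inner ℂ (v j) (v k) = ((-1) ^ j * ((j ! : ℂ)⁻¹ * (k ! : ℂ)⁻¹)) * m (j + k)) :
    ‖∑' n, v n‖ = ‖v 0‖ := by
  have hs : Summable v := hv.of_norm
  have hn : Summable fun q : ℕ × ℕ => ‖v q.1‖ * ‖v q.2‖ :=
    hv.mul_of_nonneg hv (fun _ => norm_nonneg _) (fun _ => norm_nonneg _)
  have hi : Summable fun q : ℕ × ℕ => (inner ℂ (v q.1) (v q.2) : ℂ) :=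
    Summable.of_norm_bounded hn fun q => norm_inner_le_norm _ _
  have e1 : (inner ℂ (∑' n, v n) (∑' n, v n) : ℂ) = ∑' j, ∑' k, (inner ℂ (v j) (v k) : ℂ) := by
    have hr : ∀ y : E, HasSum (fun k => (inner ℂ y (v k) : ℂ)) (inner ℂ y (∑' n, v n)) :=
      fun y => (innerSL ℂ y).hasSum hs.hasSum
    have hl : HasSum (fun j => (inner ℂ (v j) (∑' n, v n) : ℂ))
        (inner ℂ (∑' n, v n) (∑' n, v n)) := by
      have := (hr (∑' n, v n)).map (starRingEnd ℂ) Complex.continuous_conj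
      rw [inner_conj_symm] at this
      refine this.congr_fun ?_
      intro j
      exact (inner_conj_symm (𝕜 := ℂ) (v j) (∑' n, v n)).symm
    rw [← hl.tsum_eq]
    exact tsum_congr fun j => (hr (v j)).tsum_eq.symm
  have e2 : ∑' j, ∑' k, (inner ℂ (v j) (v k) : ℂ) = inner ℂ (v 0) (v 0) := by
    rw [← hi.tsum_prod, ← (Finset.HasAntidiagonal.sigmaAntidiagonalEquivProd (A := ℕ)).tsum_eq]
    have hi' := (Finset.HasAntidiagonal.sigmaAntidiagonalEquivProd (A := ℕ)).summable_iff.2 hi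
    refine (hi'.tsum_sigma).trans ?_
    rw [tsum_eq_single 0]
    · simp
    · intro n hn0
      rw [tsum_fintype]
      have := Finset.sum_coe_sort (Finset.HasAntidiagonal.antidiagonal n)
        (fun q : ℕ × ℕ => (inner ℂ (v q.1) (v q.2) : ℂ))
      refine Eq.trans this ?_
      have h0 := sum_antidiagonal_exp n
      rw [if_neg hn0] at h0
      rw [← zero_mul (m n), ← h0, Finset.sum_mul]
      refine Finset.sum_congr rfl fun q hq => ?_
      rw [Finset.HasAntidiagonal.mem_antidiagonal] at hq
      rw [hm, hq]
  have e3 := e1.trans e2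
  rw [inner_self_eq_norm_sq_to_K, inner_self_eq_norm_sq_to_K] at e3
  have e4 : ‖∑' n, v n‖ ^ 2 = ‖v 0‖ ^ 2 := by exact_mod_cast e3
  exact (sq_eq_sq₀ (norm_nonneg _) (norm_nonneg _)).1 e4

theorem norm_expSum (ξ : ℂ × ℂ) (x : finSub) : ‖expSum ξ x‖ = ‖finIncl x‖ := by
  have h := norm_tsum_of_inner (fun n => expTerm ξ n x) (summable_norm_expTerm ξ x)
    (fun n => inner ℂ (finIncl x) (finIncl ((dispFin ξ ^ n) x)))
    (fun j k => inner_expTerm ξ j k x)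
  have h0 : expTerm ξ 0 x = finIncl x := by simp [expTerm]
  rw [h0] at h
  exact h

theorem existsUnique_displacement (ξ : ℂ × ℂ) : ∃! V : Fock →L[ℂ] Fock, IsExpOf (dispGen ξ) V := by
  have hV : ∀ x : finSub, (expSum ξ).extendOfNorm finIncl (finIncl x) = expSum ξ x :=
    LinearMap.extendOfNorm_eq denseRange_finIncl ⟨1, fun x => by rw [one_mul, norm_expSum]⟩
  have hterm : ∀ (x : finSub) (n : ℕ),
      ((n ! : ℂ))⁻¹ • toFock ((dispGen ξ ^ n) x) = expTerm ξ n x := fun x n => by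
    rw [← dispFin_pow_coe]; rfl
  refine ⟨(expSum ξ).extendOfNorm finIncl, fun f hf => ?_, fun V hW => ?_⟩
  · have h := (summable_expTerm ξ ⟨f, hf⟩).hasSum
    have e : (fun n : ℕ => ((n ! : ℂ))⁻¹ • toFock ((dispGen ξ ^ n) f)) =
        fun n => expTerm ξ n ⟨f, hf⟩ := funext fun n => hterm ⟨f, hf⟩ n
    rw [e]
    have h2 := hV ⟨f, hf⟩
    change HasSum _ ((expSum ξ).extendOfNorm finIncl (finIncl ⟨f, hf⟩))
    rw [h2]
    exact h
  · refine ContinuousLinearMap.ext fun ψ => ?_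
    refine denseRange_finIncl.induction_on (p := fun ψ => V ψ = _) ψ
      (isClosed_eq V.continuous (ContinuousLinearMap.continuous _)) fun x => ?_
    rw [hV]
    have h1 := hW x x.2
    simp only [hterm] at h1
    exact h1.unique (summable_expTerm ξ x).hasSum

/-- The displacement operator `D(𝔾) = exp(-𝔾† 𝔼 𝕆)` for `𝔾 = (ξ_a, ξ_a*, ξ_b, ξ_b*)`, that is
`exp(ξ_a a† - ξ_a* a + ξ_b b† - ξ_b* b)`. -/
noncomputable def displacement (ξ : ℂ × ℂ) : Fock →L[ℂ] Fock :=
  (existsUnique_displacement ξ).exists.choose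

theorem displacement_isExpOf (ξ : ℂ × ℂ) : IsExpOf (dispGen ξ) (displacement ξ) :=
  (existsUnique_displacement ξ).exists.choose_spec

/-! ## States, characteristic function and Wigner function -/

/-- The trace, computed in the number basis. -/
noncomputable def trace (B : Fock →L[ℂ] Fock) : ℂ :=
  ∑' p, inner ℂ (numberState p) (B (numberState p))

/-- A density operator: positive, with a trace that converges to `1`. -/
def IsDensityOperator (ρ : Fock →L[ℂ] Fock) : Prop :=
  ρ.IsPositive ∧ HasSum (fun p => (inner ℂ (numberState p) (ρ (numberState p)) : ℂ)) 1

/-- The symmetric characteristic function `Tr[D(𝔾) ρ]`. -/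
noncomputable def charFun (ρ : Fock →L[ℂ] Fock) (ξ : ℂ × ℂ) : ℂ := trace (displacement ξ * ρ)

/-- The Wigner function `∫ d²ξ_a d²ξ_b / π² exp(𝔾† 𝔼 𝕏) Tr[D(𝔾) ρ]`. -/
noncomputable def wigner (ρ : Fock →L[ℂ] Fock) (X : Fin 4 → ℂ) : ℂ :=
  ∫ ξ : ℂ × ℂ, ((Real.pi : ℂ) ^ 2)⁻¹ *
    (Complex.exp (star (phaseVec ξ) ⬝ᵥ (signMat *ᵥ X)) * charFun ρ ξ)

/-- The integral `∫ W(𝕏) f(α) d²α_a d²α_b` of the Wigner function against a test function `f` of the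
phase-space point `α` of `𝕏`, for the Wigner function in the sense of tempered distributions: the
Fourier transform is moved to `f`. -/
noncomputable def wignerPairing (ρ : Fock →L[ℂ] Fock) (f : ℂ × ℂ → ℂ) : ℂ :=
  ∫ ξ : ℂ × ℂ, ((Real.pi : ℂ) ^ 2)⁻¹ *
    ((∫ α : ℂ × ℂ, Complex.exp (star (phaseVec ξ) ⬝ᵥ (signMat *ᵥ phaseVec α)) * f α) *
      charFun ρ ξ)

/-! ## Dynamics -/

/-- The matrix `𝕋` with rows `(μ_a, ν_a, χ_a, η_a)`, `(ν_a*, μ_a*, η_a*, χ_a*)` and the same for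
`b`. -/
noncomputable def dynMatrix (μa νa χa ηa μb νb χb ηb : ℂ) : Matrix (Fin 4) (Fin 4) ℂ :=
  !![μa, νa, χa, ηa;
     conj νa, conj μa, conj ηa, conj χa;
     μb, νb, χb, ηb;
     conj νb, conj μb, conj ηb, conj χb]

/-- `U† 𝕆 U = T 𝕆` on the number states, written as `𝕆 U = U (T 𝕆)`. In particular `U` maps the
number states into the domains of the ladder operators. -/
def ActsLinearly (U : Fock →L[ℂ] Fock) (T : Matrix (Fin 4) (Fin 4) ℂ) : Prop :=
  ∀ f : Amp, IsFinite f → ∀ j,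
    ladder j (U (toFock f)) = U (toFock (∑ k, T j k • ladder k f))

/-- The quadratic Hamiltonian `𝕆† h 𝕆 = ∑ h_jk 𝕆_j† 𝕆_k`. -/
noncomputable def quadHam (h : Matrix (Fin 4) (Fin 4) ℂ) : Module.End ℂ Amp :=
  ∑ j, ∑ k, h j k • (ladderDag j * ladder k)

/-- The operator of the total number of quanta, `a† a + b† b`. -/
noncomputable def number : Module.End ℂ Amp := creatA * annihA + creatB * annihB

/-- Vectors with rapidly decreasing amplitudes: those in the domains of all powers of the number
operator (the Schwartz functions of the position representation). -/
def IsSmooth (f : Amp) : Prop := ∀ k : ℕ, Memℓp ((number ^ k) f) 2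

/-- `U` is the time-evolution operator of the quadratic Hamiltonian `𝕆† h(t) 𝕆`: it preserves the
rapidly decreasing vectors, and for these it solves the Schrödinger equation
`i dU(t)ψ/dt = H(t) U(t)ψ` for `t ≥ 0`, the derivative being taken in the topology of the space of
rapidly decreasing vectors, with `U(0) = 1`. -/
structure IsEvolution (h : ℝ → Matrix (Fin 4) (Fin 4) ℂ) (U : ℝ → Fock →L[ℂ] Fock) : Prop where
  init : U 0 = 1
  smooth : ∀ t, 0 ≤ t → ∀ ψ : Fock, IsSmooth ψ → IsSmooth (U t ψ)
  schrodinger : ∀ t, 0 ≤ t → ∀ ψ : Fock, IsSmooth ψ → ∀ k : ℕ,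
    HasDerivWithinAt (fun s => toFock ((number ^ k) (U s ψ)))
      (toFock ((number ^ k) (-Complex.I • quadHam (h t) (U t ψ)))) (Set.Ici 0) t

/-- `T` solves the Heisenberg equations of motion `d𝕆_H/dt = (i [H, 𝕆])_H` for `𝕆_H = T 𝕆`, with
`T(0) = 1`: if `i [H(t), 𝕆_j] = ∑ C_jk 𝕆_k`, then `dT/dt = C T`. -/
def SolvesHeisenberg (h T : ℝ → Matrix (Fin 4) (Fin 4) ℂ) : Prop :=
  T 0 = 1 ∧ ∀ t, 0 ≤ t → ∃ C : Matrix (Fin 4) (Fin 4) ℂ,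
    (∀ j, Complex.I • (quadHam (h t) * ladder j - ladder j * quadHam (h t)) =
      ∑ k, C j k • ladder k) ∧
    ∀ j k, HasDerivWithinAt (fun s => T s j k) ((C * T t) j k) (Set.Ici 0) t

end TwoMode

open TwoMode

/-!
The ladder operators of the two modes enter through their commutators `[𝕆_j, 𝕆_k] = J_jk`
(`ladder_comm`) and through the adjointness of `𝕆_j` and `𝕆_j†` (`inner_ladderDag`).

A unitary `U` with `𝕆 U = U (T 𝕆)` gives `T J Tᵀ = J` when both sides of the commutation relations
are applied to `U|0, 0⟩` (`ActsLinearly.mul_commMat`). As complex conjugation exchanges the rows of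
`T` in pairs, this says that `T 𝔼 T† = 𝔼`, so that `T⁻¹ = 𝔼 T† 𝔼`, and that the map of phase
space defined by `T` preserves the symplectic form and hence the volume
(`measurePreserving_phaseMap`). Writing the exponential series in weak form, against finite
combinations of number states, gives `D(T 𝔾) U = U D(𝔾)` (`displacement_mul`). A density operator
is a product `S† S` of two Hilbert–Schmidt operators, which makes the trace of its products with
bounded operators cyclic (`trace_conj_isometry`), and therefore
`Tr[D(T 𝔾) ρ(t)] = Tr[D(𝔾) ρ(0)]` (`charFun_conj_phaseMap`). The three assertions about
integrability, the Wigner function and its pairing with test functions are then the change of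
variables `𝔾 ↦ T 𝔾`, which leaves `𝔾† 𝔼 𝕏` invariant when `𝕏` moves along.

For the evolution of a quadratic Hamiltonian, the Jacobi identity puts the coefficients `C` of the
Heisenberg equations into the symplectic Lie algebra (`commMat_heisenberg`). Hence `S = -J Tᵀ J`
satisfies `S' = -S C`, and `S T = 1` at all times. The vectors `∑ S_jk 𝕆_k U(t)ψ` and
`U(t) 𝕆_j ψ` solve the same Schrödinger equation, in which `C` no longer occurs, and agree at
`t = 0`. The norm of their difference is constant since the Hamiltonian is symmetric on the rapidly
decreasing vectors, so they are equal (`sum_symplInv_ladder`). This needs neither continuity nor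
boundedness of the coefficients of the Hamiltonian in time. The derivative passes through `𝕆_j` as
the ladder operators are bounded relative to the number operator (`exists_ladder_eq`).
-/

open scoped Nat ComplexConjugate Matrix

namespace TwoMode

/-! ### Commutation relations and adjoints of the ladder operators -/

/-- The matrix of the commutators, `[𝕆_j, 𝕆_k] = commMat j k`. -/
def commMat : Matrix (Fin 4) (Fin 4) ℂ :=
  !![0, 1, 0, 0; -1, 0, 0, 0; 0, 0, 0, 1; 0, 0, -1, 0]

theorem commMat_mul_self : commMat * commMat = -1 := by
  ext j k
  fin_cases j <;> fin_cases k <;> simp [commMat, Matrix.mul_apply, Fin.sum_univ_four]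

theorem ofReal_sqrt_sq {x : ℝ} (hx : 0 ≤ x) : ((√x : ℝ) : ℂ) ^ 2 = (x : ℂ) := by
  rw [← Complex.ofReal_pow, Real.sq_sqrt hx]

theorem ladder_comm (j k : Fin 4) :
    ladder j * ladder k - ladder k * ladder j = commMat j k • 1 := by
  have hs : ∀ m : ℕ, ((√(1 + (m : ℝ)) : ℝ) : ℂ) ^ 2 = 1 + m := fun m => by
    rw [ofReal_sqrt_sq (by positivity)]; push_cast; rfl
  have hs2 : ∀ m : ℕ, ((√(2 + (m : ℝ)) : ℝ) : ℂ) ^ 2 = 2 + m := fun m => by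
    rw [ofReal_sqrt_sq (by positivity)]; push_cast; rfl
  refine LinearMap.ext fun f => funext fun p => ?_
  obtain ⟨m, n⟩ := p
  fin_cases j <;> fin_cases k <;> rcases m with _ | m <;> rcases n with _ | n <;>
    simp [ladder, commMat, annihA, annihB, creatA, creatB] <;>
    first | done | ring1 | (ring_nf; simp only [hs, hs2]; ring1)

theorem number_apply (f : Amp) (p : ℕ × ℕ) : number f p = ((p.1 + p.2 : ℕ) : ℂ) * f p := by
  obtain ⟨m, n⟩ := p
  have hs : ∀ m : ℕ, ((√(1 + (m : ℝ)) : ℝ) : ℂ) ^ 2 = 1 + m := fun m => by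
    rw [ofReal_sqrt_sq (by positivity)]; push_cast; rfl
  rcases m with _ | m <;> rcases n with _ | n <;>
    simp [number, annihA, annihB, creatA, creatB] <;> ring_nf <;> simp only [hs] <;> ring

theorem inner_toFock_of_memℓp {f g : Amp} (hf : Memℓp f 2) (hg : Memℓp g 2) :
    inner ℂ (toFock f) (toFock g) = ∑' p, conj (f p) * g p := by
  rw [lp.inner_eq_tsum, toFock_coe hf, toFock_coe hg]
  exact tsum_congr fun p => by rw [RCLike.inner_apply, mul_comm]

theorem inner_creatA (f g : Amp) :
    ∑' p, conj (creatA f p) * g p = ∑' p, conj (f p) * annihA g p := by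
  have h := congrArg conj (inner_annihA g f)
  simp only [Complex.conj_tsum, map_mul, RCLike.conj_conj] at h
  simpa only [mul_comm] using h.symm

theorem inner_creatB (f g : Amp) :
    ∑' p, conj (creatB f p) * g p = ∑' p, conj (f p) * annihB g p := by
  have h := congrArg conj (inner_annihB g f)
  simp only [Complex.conj_tsum, map_mul, RCLike.conj_conj] at h
  simpa only [mul_comm] using h.symm

theorem inner_ladderDag {f g : Amp} (j : Fin 4) (hf : Memℓp f 2) (hg : Memℓp g 2)
    (hf' : Memℓp (ladderDag j f) 2) (hg' : Memℓp (ladder j g) 2) :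
    inner ℂ (toFock (ladderDag j f)) (toFock g) = inner ℂ (toFock f) (toFock (ladder j g)) := by
  rw [inner_toFock_of_memℓp hf' hg, inner_toFock_of_memℓp hf hg']
  fin_cases j
  exacts [inner_creatA f g, inner_annihA f g, inner_creatB f g, inner_annihB f g]

theorem isFinite_ladder (j : Fin 4) {f : Amp} (hf : IsFinite f) : IsFinite (ladder j f) := by
  fin_cases j
  exacts [isFinite_annihA hf, isFinite_creatA hf, isFinite_annihB hf, isFinite_creatB hf]

theorem isFinite_ladderDag (j : Fin 4) {f : Amp} (hf : IsFinite f) :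
    IsFinite (ladderDag j f) := by
  fin_cases j
  exacts [isFinite_creatA hf, isFinite_annihA hf, isFinite_creatB hf, isFinite_annihB hf]

theorem isFinite_sum_ladder (c : Fin 4 → ℂ) {f : Amp} (hf : IsFinite f) :
    IsFinite (∑ k, c k • ladder k f) :=
  finSub.sum_mem fun k _ => finSub.smul_mem _ (isFinite_ladder k hf)

theorem toFock_add {f g : Amp} (hf : Memℓp f 2) (hg : Memℓp g 2) :
    toFock (f + g) = toFock f + toFock g := by
  refine lp.ext ?_
  rw [lp.coeFn_add, toFock_coe (hf.add hg), toFock_coe hf, toFock_coe hg]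

theorem toFock_smul (c : ℂ) {f : Amp} (hf : Memℓp f 2) : toFock (c • f) = c • toFock f := by
  refine lp.ext ?_
  rw [lp.coeFn_smul, toFock_coe (hf.const_smul c), toFock_coe hf]

theorem toFock_sum {f : Fin 4 → Amp} (hf : ∀ k, Memℓp (f k) 2) (c : Fin 4 → ℂ) :
    toFock (∑ k, c k • f k) = ∑ k, c k • toFock (f k) := by
  have h := fun k => (hf k).const_smul (c k)
  simp only [Fin.sum_univ_four]
  rw [toFock_add (((h 0).add (h 1)).add (h 2)) (h 3), toFock_add ((h 0).add (h 1)) (h 2),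
    toFock_add (h 0) (h 1)]
  simp only [toFock_smul _ (hf _)]

theorem eq_of_finite_eq {E : Type*} [NormedAddCommGroup E] [NormedSpace ℂ E]
    {V W : Fock →L[ℂ] E} (h : ∀ f, IsFinite f → V (toFock f) = W (toFock f)) : V = W := by
  refine ContinuousLinearMap.ext fun ψ => ?_
  exact denseRange_finIncl.induction_on (p := fun ψ => V ψ = W ψ) ψ
    (isClosed_eq V.continuous W.continuous) fun x => h x x.2

theorem eq_of_inner_finite {ψ η : Fock}
    (h : ∀ g, IsFinite g → (inner ℂ (toFock g) ψ : ℂ) = inner ℂ (toFock g) η) : ψ = η := by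
  refine ext_inner_left ℂ fun χ => ?_
  exact denseRange_finIncl.induction_on (p := fun χ => (inner ℂ χ ψ : ℂ) = inner ℂ χ η) χ
    (isClosed_eq (by fun_prop) (by fun_prop)) fun x => h x x.2

/-! ### Covariance of the displacement operators -/

theorem dispGen_eq_ladderDag (ξ : ℂ × ℂ) (f : Amp) :
    dispGen ξ f = ∑ j, conj ((star (phaseVec ξ) ᵥ* signMat) j) • ladderDag j f := by
  simp only [dispGen_eq, signMat, Matrix.vecMul_diagonal, Fin.sum_univ_four, phaseVec, ladderDag]
  simp
  module

theorem dispGen_apply (ξ : ℂ × ℂ) (f : Amp) :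
    dispGen ξ f = ∑ j, (-(star (phaseVec ξ) ᵥ* signMat) j) • ladder j f := by
  simp [dispGen, LinearMap.sum_apply, Finset.sum_neg_distrib]

theorem dispGen_neg (ξ : ℂ × ℂ) : dispGen (-ξ) = -dispGen ξ := by
  simp only [dispGen_eq]
  simp
  module

theorem dispGen_neg_pow (ξ : ℂ × ℂ) (n : ℕ) (f : Amp) :
    (dispGen (-ξ) ^ n) f = (-1 : ℂ) ^ n • (dispGen ξ ^ n) f := by
  rw [dispGen_neg]
  rcases n.even_or_odd with h | h
  · rw [h.neg_pow (dispGen ξ), h.neg_one_pow, one_smul]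
  · rw [h.neg_pow (dispGen ξ), h.neg_one_pow, LinearMap.neg_apply, neg_one_smul]

/-- `D(𝔾)† = D(-𝔾)`, on finite combinations of number states. -/
theorem inner_displacement (ξ : ℂ × ℂ) {g : Amp} (hg : IsFinite g) (ψ : Fock) :
    (inner ℂ (toFock g) (displacement ξ ψ) : ℂ) = inner ℂ (displacement (-ξ) (toFock g)) ψ := by
  suffices h : (innerSL ℂ (toFock g)).comp (displacement ξ) =
      innerSL ℂ (displacement (-ξ) (toFock g)) from congrArg (fun L : Fock →L[ℂ] ℂ => L ψ) h
  refine eq_of_finite_eq fun f hf => ?_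
  change (inner ℂ (toFock g) (displacement ξ (toFock f)) : ℂ) =
    inner ℂ (displacement (-ξ) (toFock g)) (toFock f)
  have h1 := (innerSL ℂ (toFock g)).hasSum (displacement_isExpOf ξ f hf)
  have h2 := ((innerSL ℂ (toFock f)).hasSum (displacement_isExpOf (-ξ) g hg)).map
    (starRingEnd ℂ) Complex.continuous_conj
  simp only [innerSL_apply_apply, inner_conj_symm] at h1 h2
  refine h1.unique (h2.congr_fun fun n => ?_)
  have h3 := inner_dispFin_pow (-ξ) n ⟨g, hg⟩ ⟨f, hf⟩
  have e1 : (finIncl ((dispFin (-ξ) ^ n) ⟨g, hg⟩)) = toFock ((dispGen (-ξ) ^ n) g) :=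
    congrArg toFock (dispFin_pow_coe _ n _)
  have e2 : (finIncl ((dispFin (-ξ) ^ n) ⟨f, hf⟩)) = (-1 : ℂ) ^ n • toFock ((dispGen ξ ^ n) f) := by
    rw [← toFock_smul]
    · exact congrArg toFock ((dispFin_pow_coe _ n _).trans (dispGen_neg_pow ξ n f))
    · rw [← dispFin_pow_coe ξ n ⟨f, hf⟩]
      exact IsFinite.memℓp (Subtype.prop _)
  rw [e1, e2, inner_smul_right, ← mul_assoc, ← mul_pow, neg_mul_neg, one_mul, one_pow,
    one_mul] at h3
  simp only [Function.comp, inner_smul_right, map_mul, inner_conj_symm, map_inv₀, map_natCast]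
  exact congrArg _ h3.symm

/-- The `n`-th terms of the exponential series of `D(-𝔾)` and `D(𝔾')` agree in weak form. Powers of
the generator only act on finite combinations of number states, never on vectors `U f`. -/
theorem inner_dispGen_pow {U : Fock →L[ℂ] Fock} {T : Matrix (Fin 4) (Fin 4) ℂ}
    (hU : ActsLinearly U T) {ξ ζ : ℂ × ℂ}
    (hζ : star (phaseVec ξ) ᵥ* signMat ᵥ* T = star (phaseVec ζ) ᵥ* signMat) (n : ℕ) :
    ∀ f g : Amp, IsFinite f → IsFinite g →
      (inner ℂ (toFock ((dispGen (-ξ) ^ n) g)) (U (toFock f)) : ℂ) =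
        inner ℂ (toFock g) (U (toFock ((dispGen ζ ^ n) f))) := by
  induction n with
  | zero => intro f g _ _; simp
  | succ n ih =>
    intro f g hf hg
    rw [pow_succ, Module.End.mul_apply, ih f _ hf (dispGen_mem (-ξ) g hg), pow_succ',
      Module.End.mul_apply]
    have hf' : IsFinite ((dispGen ζ ^ n) f) := by
      rw [← dispFin_pow_coe ζ n ⟨f, hf⟩]
      exact Subtype.prop _
    set f' := (dispGen ζ ^ n) f
    have hl : ∀ j, ladder j (U (toFock f')) = U (toFock (∑ k, T j k • ladder k f')) := hU f' hf'
    have hj : ∀ j, (inner ℂ (toFock (ladderDag j g)) (U (toFock f')) : ℂ) =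
        inner ℂ (toFock g) (U (toFock (∑ k, T j k • ladder k f'))) := fun j => by
      have h := inner_ladderDag (g := U (toFock f')) j hg.memℓp (lp.memℓp _)
        (isFinite_ladderDag j hg).memℓp (by rw [hl]; exact lp.memℓp _)
      rwa [hl, toFock_self, toFock_self] at h
    set c := star (phaseVec ξ) ᵥ* signMat with hc
    -- The generator is anti-Hermitian: expanded in `𝕆†` on the left, in `𝕆` on the right.
    have e1 : dispGen (-ξ) g = ∑ j, (-conj (c j)) • ladderDag j g := by
      rw [dispGen_neg, LinearMap.neg_apply, dispGen_eq_ladderDag, ← hc]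
      simp [Finset.sum_neg_distrib]
    have e2 : dispGen ζ f' = ∑ j, (-c j) • ∑ k, T j k • ladder k f' := by
      rw [dispGen_apply, ← hζ]
      simp only [Finset.smul_sum, smul_smul]
      rw [Finset.sum_comm]
      refine Finset.sum_congr rfl fun k _ => ?_
      rw [← Finset.sum_smul]
      simp [Matrix.vecMul, dotProduct, Finset.sum_neg_distrib]
    rw [e1, e2, toFock_sum fun j => (isFinite_ladderDag j hg).memℓp,
      toFock_sum fun j => (isFinite_sum_ladder (fun k => T j k) hf').memℓp, map_sum, sum_inner,
      inner_sum]
    refine Finset.sum_congr rfl fun j _ => ?_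
    rw [inner_smul_left, map_smul, inner_smul_right, hj, map_neg, RCLike.conj_conj]

/-- `D(𝔾) U = U D(𝔾')` for a linear action `U† 𝕆 U = T 𝕆`, where `𝔾'† 𝔼 = 𝔾† 𝔼 T`. -/
theorem displacement_mul {U : Fock →L[ℂ] Fock} {T : Matrix (Fin 4) (Fin 4) ℂ}
    (hU : ActsLinearly U T) {ξ ζ : ℂ × ℂ}
    (hζ : star (phaseVec ξ) ᵥ* signMat ᵥ* T = star (phaseVec ζ) ᵥ* signMat) :
    displacement ξ * U = U * displacement ζ := by
  refine eq_of_finite_eq fun f hf => eq_of_inner_finite fun g hg => ?_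
  simp only [mul_apply_eq_comp]
  rw [inner_displacement ξ hg]
  have h1 := ((innerSL ℂ (U (toFock f))).hasSum (displacement_isExpOf (-ξ) g hg)).map
    (starRingEnd ℂ) Complex.continuous_conj
  have h2 := ((innerSL ℂ (toFock g)).comp U).hasSum (displacement_isExpOf ζ f hf)
  simp only [innerSL_apply_apply, inner_conj_symm] at h1
  refine h1.unique (h2.congr_fun fun n => ?_)
  simp only [Function.comp, ContinuousLinearMap.comp_apply, innerSL_apply_apply, map_smul,
    inner_smul_right, map_mul, inner_conj_symm, map_inv₀, map_natCast]
  rw [inner_dispGen_pow hU hζ n f g hf hg, smul_eq_mul]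

/-! ### Cyclicity of the trace -/

theorem inner_numberState (p : ℕ × ℕ) (ψ : Fock) : (inner ℂ (numberState p) ψ : ℂ) = ψ p := by
  rw [numberState, lp.inner_single_left]
  simp

theorem adjoint_numberState_apply (X : Fock →L[ℂ] Fock) (p q : ℕ × ℕ) :
    (star X (numberState p) : Fock) q = conj ((X (numberState q) : Fock) p) := by
  rw [← inner_numberState, ← inner_numberState, ContinuousLinearMap.star_eq_adjoint,
    ContinuousLinearMap.adjoint_inner_right, inner_conj_symm]

/-- A Hilbert–Schmidt operator, by its square-summable columns in the number basis. -/
def IsHilbertSchmidt (X : Fock →L[ℂ] Fock) : Prop :=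
  Summable fun p => ‖X (numberState p)‖ ^ 2

theorem hasSum_norm_sq (ψ : Fock) : HasSum (fun q => ‖ψ q‖ ^ 2) (‖ψ‖ ^ 2) := by
  have h := lp.hasSum_norm (p := 2) (by simp) ψ
  simpa using h

theorem IsHilbertSchmidt.summable_entries {X : Fock →L[ℂ] Fock} (hX : IsHilbertSchmidt X) :
    Summable fun z : (ℕ × ℕ) × (ℕ × ℕ) => ‖(X (numberState z.1) : Fock) z.2‖ ^ 2 := by
  rw [summable_prod_of_nonneg fun _ => by positivity]
  refine ⟨fun p => (hasSum_norm_sq (X (numberState p))).summable, ?_⟩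
  exact hX.congr fun p => (hasSum_norm_sq (X (numberState p))).tsum_eq.symm

theorem IsHilbertSchmidt.star {X : Fock →L[ℂ] Fock} (hX : IsHilbertSchmidt X) :
    IsHilbertSchmidt (star X) := by
  have h := hX.summable_entries.prod_symm
  rw [summable_prod_of_nonneg fun _ => by positivity] at h
  refine h.2.congr fun p => ?_
  rw [← (hasSum_norm_sq (Star.star X (numberState p))).tsum_eq]
  refine tsum_congr fun q => ?_
  rw [adjoint_numberState_apply, RCLike.norm_conj]
  rfl

theorem IsHilbertSchmidt.left_mul {X : Fock →L[ℂ] Fock} (hX : IsHilbertSchmidt X)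
    (V : Fock →L[ℂ] Fock) : IsHilbertSchmidt (V * X) := by
  refine Summable.of_nonneg_of_le (fun _ => by positivity) (fun p => ?_) 
    (Summable.mul_left (‖V‖ ^ 2) hX)
  rw [← mul_pow, mul_apply_eq_comp]
  gcongr
  exact V.le_opNorm _

/-- The trace of the product of two Hilbert–Schmidt operators does not depend on their order: both
traces are the sum of an absolutely summable double series. -/
theorem IsHilbertSchmidt.trace_star_mul {X Y : Fock →L[ℂ] Fock} (hX : IsHilbertSchmidt X)
    (hY : IsHilbertSchmidt Y) : trace (Star.star X * Y) = trace (Y * Star.star X) := by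
  have e1 : trace (Star.star X * Y) =
      ∑' p, ∑' q, conj ((X (numberState p) : Fock) q) * (Y (numberState p) : Fock) q := by
    refine tsum_congr fun p => ?_
    rw [mul_apply_eq_comp, ContinuousLinearMap.star_eq_adjoint,
      ContinuousLinearMap.adjoint_inner_right, lp.inner_eq_tsum]
    exact tsum_congr fun q => by rw [RCLike.inner_apply, mul_comm]
  have e2 : trace (Y * Star.star X) =
      ∑' q, ∑' p, conj ((X (numberState p) : Fock) q) * (Y (numberState p) : Fock) q := by
    refine tsum_congr fun q => ?_
    rw [mul_apply_eq_comp, ← ContinuousLinearMap.adjoint_inner_left,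
      ← ContinuousLinearMap.star_eq_adjoint, lp.inner_eq_tsum]
    refine tsum_congr fun p => ?_
    rw [RCLike.inner_apply, adjoint_numberState_apply, adjoint_numberState_apply,
      RCLike.conj_conj]
  rw [e1, e2]
  refine (Summable.tsum_comm ?_).symm
  refine Summable.of_norm_bounded (hX.summable_entries.add hY.summable_entries) fun z => ?_
  simp only [Function.uncurry, norm_mul, RCLike.norm_conj]
  nlinarith [sq_nonneg (‖(X (numberState z.1) : Fock) z.2‖ - ‖(Y (numberState z.1) : Fock) z.2‖),
    sq_nonneg (‖(X (numberState z.1) : Fock) z.2‖ + ‖(Y (numberState z.1) : Fock) z.2‖)]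

theorem exists_eq_star_mul_self {H : Type*} [NormedAddCommGroup H] [InnerProductSpace ℂ H]
    [CompleteSpace H] {ρ : H →L[ℂ] H} (h : ρ.IsPositive) : ∃ S : H →L[ℂ] H, ρ = star S * S := by
  rw [← ContinuousLinearMap.nonneg_iff_isPositive] at h
  exact CStarAlgebra.nonneg_iff_eq_star_mul_self.1 h

/-- The trace of `V ρ` does not change under conjugation by an isometry. -/
theorem trace_conj_isometry {ρ : Fock →L[ℂ] Fock} (hρ : IsDensityOperator ρ)
    (V : Fock →L[ℂ] Fock) {U : Fock →L[ℂ] Fock} (hU : star U * U = 1) :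
    trace (U * (V * ρ) * star U) = trace (V * ρ) := by
  obtain ⟨S, rfl⟩ := exists_eq_star_mul_self hρ.1
  have hS : IsHilbertSchmidt S := by
    have h := hρ.2.summable.map Complex.reCLM Complex.continuous_re
    refine h.congr fun p => ?_
    simp only [Function.comp, mul_apply_eq_comp]
    rw [ContinuousLinearMap.star_eq_adjoint, ContinuousLinearMap.adjoint_inner_right,
      inner_self_eq_norm_sq_to_K]
    change Complex.re ((‖S (numberState p)‖ : ℂ) ^ 2) = _
    rw [← Complex.ofReal_pow, Complex.ofReal_re]
  -- With `ρ = S† S`, both traces are equal to the trace of `S V S†`.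
  have h1 := (hS.star.left_mul U).trace_star_mul (hS.star.left_mul (U * V))
  have h2 := hS.star.trace_star_mul (hS.star.left_mul V)
  rw [star_mul, star_star] at h1
  rw [star_star] at h2
  have a1 : U * (V * (star S * S)) * star U = U * V * star S * (S * star U) := by
    simp only [mul_assoc]
  have a2 : S * star U * (U * V * star S) = S * (star U * U) * (V * star S) := by
    simp only [mul_assoc]
  rw [a1, ← h1, a2, hU, mul_one, h2, mul_assoc]

/-! ### The symplectic structure of a linear action -/

/-- A linear action preserves the commutators: they are evaluated on the vector `U|0, 0⟩ ≠ 0`. -/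
theorem ActsLinearly.mul_commMat {U : Fock →L[ℂ] Fock} {T : Matrix (Fin 4) (Fin 4) ℂ}
    (hU : ActsLinearly U T) (hinj : Function.Injective U) : T * commMat * Tᵀ = commMat := by
  set f : Amp := Pi.single 0 1 with hf
  have hfin : IsFinite f := (Set.finite_singleton _).subset Pi.support_single_subset
  have h2 : ∀ j k, ladder j (ladder k (U (toFock f))) =
      U (toFock (∑ m, T j m • ladder m (∑ l, T k l • ladder l f))) := fun j k => by
    rw [hU f hfin, hU _ (isFinite_sum_ladder (fun l => T k l) hfin)]
  have hne : (U (toFock f) : Amp) ≠ 0 := by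
    intro h
    have h0 : U (toFock f) = U 0 := by rw [map_zero]; exact lp.ext h
    have h1 := congrArg (fun ψ : Fock => ψ 0) (hinj h0)
    simp only [toFock_apply hfin] at h1
    simp [hf] at h1
  ext j k
  have h3 := LinearMap.congr_fun (ladder_comm j k) (U (toFock f))
  have hm : ∀ j k, Memℓp (∑ m, T j m • ladder m (∑ l, T k l • ladder l f)) 2 := fun j k =>
    (isFinite_sum_ladder (fun m => T j m) (isFinite_sum_ladder (fun l => T k l) hfin)).memℓp
  rw [LinearMap.sub_apply, Module.End.mul_apply, Module.End.mul_apply, h2, h2,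
    ← lp.coeFn_sub, ← map_sub] at h3
  have h4 : toFock (∑ m, T j m • ladder m (∑ l, T k l • ladder l f)) -
      toFock (∑ m, T k m • ladder m (∑ l, T j l • ladder l f)) =
      (T * commMat * Tᵀ) j k • toFock f := by
    rw [← toFock_smul _ hfin.memℓp, sub_eq_iff_eq_add, ← toFock_add (hfin.memℓp.const_smul _)
      (hm k j)]
    congr 1
    rw [← sub_eq_iff_eq_add]
    simp only [map_sum, map_smul, Finset.smul_sum, smul_smul]
    rw [Finset.sum_comm (f := fun m l => (T k m * T j l) • ladder m (ladder l f)),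
      ← Finset.sum_sub_distrib]
    simp only [← Finset.sum_sub_distrib, Matrix.mul_apply, Finset.sum_mul, Finset.sum_smul]
    rw [Finset.sum_comm]
    refine Finset.sum_congr rfl fun l _ => Finset.sum_congr rfl fun m _ => ?_
    have h5 := LinearMap.congr_fun (ladder_comm m l) f
    rw [mul_comm (T k l), ← smul_sub]
    rw [LinearMap.sub_apply, Module.End.mul_apply, Module.End.mul_apply] at h5
    rw [h5, LinearMap.smul_apply, Module.End.one_apply, smul_smul, Matrix.transpose_apply]
    congr 1
    ring
  rw [h4, map_smul, lp.coeFn_smul, LinearMap.smul_apply, Module.End.one_apply] at h3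
  exact smul_left_injective ℂ hne h3

/-! ### Linear symplectic maps of phase space -/

/-- The permutation of the coordinates `(z_a, z_a*, z_b, z_b*)` by complex conjugation. -/
def conjMat : Matrix (Fin 4) (Fin 4) ℂ := !![0, 1, 0, 0; 1, 0, 0, 0; 0, 0, 0, 1; 0, 0, 1, 0]

theorem conjMat_mul_self : conjMat * conjMat = 1 := by
  ext j k
  fin_cases j <;> fin_cases k <;> simp [conjMat, Matrix.mul_apply, Fin.sum_univ_four]

theorem commMat_mul_conjMat : commMat * conjMat = signMat := by
  ext j k
  fin_cases j <;> fin_cases k <;>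
    simp [conjMat, commMat, signMat, Matrix.mul_apply, Fin.sum_univ_four]

theorem signMat_mul_self : signMat * signMat = 1 := by
  rw [signMat, Matrix.diagonal_mul_diagonal, ← Matrix.diagonal_one]
  congr 1
  ext j
  fin_cases j <;> simp

theorem conjTranspose_dynMatrix (μa νa χa ηa μb νb χb ηb : ℂ) :
    (dynMatrix μa νa χa ηa μb νb χb ηb)ᴴ =
      conjMat * (dynMatrix μa νa χa ηa μb νb χb ηb)ᵀ * conjMat := by
  ext j k
  simp only [Matrix.mul_apply, Fin.sum_univ_four]
  fin_cases j <;> fin_cases k <;> simp [conjMat, dynMatrix]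

theorem mul_signMat_mul_conjTranspose {T : Matrix (Fin 4) (Fin 4) ℂ}
    (hT : Tᴴ = conjMat * Tᵀ * conjMat) (h : T * commMat * Tᵀ = commMat) :
    T * signMat * Tᴴ = signMat := by
  calc T * signMat * Tᴴ = T * commMat * (conjMat * conjMat) * Tᵀ * conjMat := by
        rw [hT, ← commMat_mul_conjMat]
        simp only [Matrix.mul_assoc]
    _ = signMat := by rw [conjMat_mul_self, Matrix.mul_one, h, commMat_mul_conjMat]

/-- The action of a matrix on the phase-space points `(z_a, z_b)`. -/
noncomputable def phaseMap (T : Matrix (Fin 4) (Fin 4) ℂ) : ℂ × ℂ →ₗ[ℝ] ℂ × ℂ where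
  toFun z := ((T *ᵥ phaseVec z) 0, (T *ᵥ phaseVec z) 2)
  map_add' z w := by
    ext <;> simp [Matrix.mulVec, dotProduct, Fin.sum_univ_four, phaseVec] <;> ring
  map_smul' c z := by
    ext <;> simp [Matrix.mulVec, dotProduct, Fin.sum_univ_four, phaseVec] <;> ring

theorem phaseVec_phaseMap (μa νa χa ηa μb νb χb ηb : ℂ) (z : ℂ × ℂ) :
    phaseVec (phaseMap (dynMatrix μa νa χa ηa μb νb χb ηb) z) =
      dynMatrix μa νa χa ηa μb νb χb ηb *ᵥ phaseVec z := by
  ext j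
  fin_cases j <;>
    simp [phaseMap, phaseVec, dynMatrix, Matrix.mulVec, dotProduct, Fin.sum_univ_four] <;> ring

theorem inv_dynMatrix_mulVec (μa νa χa ηa μb νb χb ηb : ℂ) (α : ℂ × ℂ) :
    (signMat * (dynMatrix μa νa χa ηa μb νb χb ηb)ᴴ * signMat) *ᵥ phaseVec α = phaseVec
      (conj μa * α.1 - νa * conj α.1 + conj μb * α.2 - νb * conj α.2,
        conj χa * α.1 - ηa * conj α.1 + conj χb * α.2 - ηb * conj α.2) := by
  ext j
  rw [signMat]
  simp only [Matrix.mulVec, dotProduct, Matrix.mul_diagonal, Matrix.diagonal_mul]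
  fin_cases j <;> simp [phaseVec, dynMatrix, Fin.sum_univ_four] <;> ring

/-- The symplectic form `Im (u_a* v_a + u_b* v_b)` of the phase space. -/
noncomputable def symplForm : LinearMap.BilinForm ℝ (ℂ × ℂ) :=
  LinearMap.mk₂ ℝ (fun u v => (conj u.1 * v.1 + conj u.2 * v.2).im)
    (fun u u' v => by simp; ring) (fun c u v => by simp; ring)
    (fun u v v' => by simp; ring) (fun c u v => by simp; ring)

theorem dotProduct_signMat (u v : ℂ × ℂ) :
    star (phaseVec u) ⬝ᵥ (signMat *ᵥ phaseVec v) = 2 * Complex.I * symplForm u v := by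
  simp [signMat, phaseVec, Matrix.mulVec_diagonal, dotProduct, Fin.sum_univ_four, symplForm,
    Complex.ext_iff]
  ring

theorem symplForm_nondegenerate : symplForm.Nondegenerate := by
  have key : ∀ u : ℂ × ℂ, symplForm u (Complex.I • u) = ‖u.1‖ ^ 2 + ‖u.2‖ ^ 2 := fun u => by
    simp [symplForm, Complex.sq_norm, Complex.normSq_apply]
  have hz : ∀ u : ℂ × ℂ, ‖u.1‖ ^ 2 + ‖u.2‖ ^ 2 = 0 → u = 0 := fun u h => by
    have h1 : ‖u.1‖ = 0 := by nlinarith [sq_nonneg ‖u.1‖, sq_nonneg ‖u.2‖]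
    have h2 : ‖u.2‖ = 0 := by nlinarith [sq_nonneg ‖u.1‖, sq_nonneg ‖u.2‖]
    exact Prod.ext (norm_eq_zero.1 h1) (norm_eq_zero.1 h2)
  have hs : ∀ u v, symplForm u v = -symplForm v u := fun u v => by
    simp [symplForm]
    ring
  refine ⟨fun u hu => hz u ?_, fun u hu => hz u ?_⟩
  · rw [← key, hu]
  · rw [← key, hs, hu, neg_zero]

theorem det_phaseMap_sq {T : Matrix (Fin 4) (Fin 4) ℂ}
    (hv : ∀ z, phaseVec (phaseMap T z) = T *ᵥ phaseVec z) (hT : Tᴴ * signMat * T = signMat) :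
    LinearMap.det (phaseMap T) ^ 2 = 1 := by
  have hf : ∀ u v, symplForm (phaseMap T u) (phaseMap T v) = symplForm u v := fun u v => by
    have h : star (phaseVec (phaseMap T u)) ⬝ᵥ (signMat *ᵥ phaseVec (phaseMap T v)) =
        star (phaseVec u) ⬝ᵥ (signMat *ᵥ phaseVec v) := by
      conv_rhs => rw [← hT]
      rw [hv, hv, Matrix.star_mulVec]
      simp only [Matrix.mulVec_mulVec, Matrix.dotProduct_mulVec, Matrix.vecMul_vecMul,
        Matrix.mul_assoc]
    rw [dotProduct_signMat, dotProduct_signMat] at h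
    exact_mod_cast mul_left_cancel₀ (by simp) h
  have hc : symplForm.comp (phaseMap T) (phaseMap T) = symplForm :=
    LinearMap.ext fun u => LinearMap.ext fun v => hf u v
  set b := Module.finBasis ℝ (ℂ × ℂ)
  have h1 := LinearMap.BilinForm.toMatrix_comp b b symplForm (phaseMap T) (phaseMap T)
  have h2 := (LinearMap.BilinForm.nondegenerate_iff_det_ne_zero b).1 symplForm_nondegenerate
  rw [hc] at h1
  have h3 := congrArg Matrix.det h1
  rw [Matrix.det_mul, Matrix.det_mul, Matrix.det_transpose, LinearMap.det_toMatrix] at h3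
  refine mul_right_cancel₀ h2 ?_
  linear_combination -h3

/-- A symplectic map of phase space preserves the volume, as its determinant is `±1`. -/
theorem measurePreserving_phaseMap {T : Matrix (Fin 4) (Fin 4) ℂ}
    (hv : ∀ z, phaseVec (phaseMap T z) = T *ᵥ phaseVec z) (hT : Tᴴ * signMat * T = signMat) :
    MeasureTheory.MeasurePreserving (phaseMap T) ∧ MeasurableEmbedding (phaseMap T) := by
  have hd := det_phaseMap_sq hv hT
  have h0 : LinearMap.det (phaseMap T) ≠ 0 := fun h => by simp [h] at hd
  have hc : Continuous (phaseMap T) := LinearMap.continuous_of_finiteDimensional _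
  have hm : (MeasureTheory.volume : MeasureTheory.Measure (ℂ × ℂ)).IsAddHaarMeasure :=
    MeasureTheory.Measure.prod.instIsAddHaarMeasure _ _
  refine ⟨⟨hc.measurable, ?_⟩, ?_⟩
  · rw [MeasureTheory.Measure.map_linearMap_addHaar_eq_smul_addHaar _ h0, abs_inv,
      (pow_eq_one_iff_of_nonneg (abs_nonneg _) two_ne_zero).1 ((sq_abs _).trans hd)]
    simp
  · exact hc.measurableEmbedding (LinearMap.equivOfDetNeZero (phaseMap T) h0).injective

/-! ### Characteristic and Wigner functions under a linear action -/

section LinearAction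

variable {U : Fock →L[ℂ] Fock} {T : Matrix (Fin 4) (Fin 4) ℂ} {ρ : Fock →L[ℂ] Fock}

theorem charFun_conj_phaseMap (hU : ActsLinearly U T) (hU' : star U * U = 1)
    (hv : ∀ z, phaseVec (phaseMap T z) = T *ᵥ phaseVec z) (hT : Tᴴ * signMat * T = signMat)
    (hρ : IsDensityOperator ρ) (ζ : ℂ × ℂ) :
    charFun (U * ρ * star U) (phaseMap T ζ) = charFun ρ ζ := by
  have h : star (phaseVec (phaseMap T ζ)) ᵥ* signMat ᵥ* T = star (phaseVec ζ) ᵥ* signMat := by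
    rw [hv, Matrix.star_mulVec, Matrix.vecMul_vecMul, Matrix.vecMul_vecMul,
      ← mul_assoc, hT]
  rw [charFun, charFun, ← trace_conj_isometry hρ _ hU', ← mul_assoc, ← mul_assoc,
    displacement_mul hU h]
  simp only [mul_assoc]

theorem integrable_charFun_conj_iff (hU : ActsLinearly U T) (hU' : star U * U = 1)
    (hv : ∀ z, phaseVec (phaseMap T z) = T *ᵥ phaseVec z) (hT : Tᴴ * signMat * T = signMat)
    (hρ : IsDensityOperator ρ) :
    MeasureTheory.Integrable (charFun (U * ρ * star U)) ↔
      MeasureTheory.Integrable (charFun ρ) := by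
  obtain ⟨hm, he⟩ := measurePreserving_phaseMap hv hT
  rw [← hm.integrable_comp_emb he]
  exact iff_of_eq (congrArg (MeasureTheory.Integrable · MeasureTheory.volume)
    (funext (charFun_conj_phaseMap hU hU' hv hT hρ)))

theorem star_phaseVec_phaseMap_dotProduct
    (hv : ∀ z, phaseVec (phaseMap T z) = T *ᵥ phaseVec z) (hT : Tᴴ * signMat * T = signMat)
    (ζ : ℂ × ℂ) (Z : Fin 4 → ℂ) :
    star (phaseVec (phaseMap T ζ)) ⬝ᵥ (signMat *ᵥ (T *ᵥ Z)) =
      star (phaseVec ζ) ⬝ᵥ (signMat *ᵥ Z) := by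
  rw [hv, Matrix.star_mulVec, ← Matrix.dotProduct_mulVec, Matrix.mulVec_mulVec,
    Matrix.mulVec_mulVec, hT]

theorem wigner_conj (hU : ActsLinearly U T) (hU' : star U * U = 1)
    (hv : ∀ z, phaseVec (phaseMap T z) = T *ᵥ phaseVec z) (hT : Tᴴ * signMat * T = signMat)
    (hρ : IsDensityOperator ρ) (Z : Fin 4 → ℂ) :
    wigner (U * ρ * star U) (T *ᵥ Z) = wigner ρ Z := by
  obtain ⟨hm, he⟩ := measurePreserving_phaseMap hv hT
  rw [wigner, ← hm.integral_comp he, wigner]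
  simp only [charFun_conj_phaseMap hU hU' hv hT hρ, star_phaseVec_phaseMap_dotProduct hv hT]

theorem wignerPairing_conj (hU : ActsLinearly U T) (hU' : star U * U = 1)
    (hv : ∀ z, phaseVec (phaseMap T z) = T *ᵥ phaseVec z) (hT : Tᴴ * signMat * T = signMat)
    (hρ : IsDensityOperator ρ) (f : ℂ × ℂ → ℂ) :
    wignerPairing (U * ρ * star U) f = wignerPairing ρ fun γ => f (phaseMap T γ) := by
  obtain ⟨hm, he⟩ := measurePreserving_phaseMap hv hT
  rw [wignerPairing, ← hm.integral_comp he, wignerPairing]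
  congr 1
  funext ζ
  rw [charFun_conj_phaseMap hU hU' hv hT hρ, ← hm.integral_comp he]
  congr 3
  funext γ
  rw [hv γ, star_phaseVec_phaseMap_dotProduct hv hT]

end LinearAction

/-! ### Rapidly decreasing vectors -/

theorem number_pow_apply (k : ℕ) (f : Amp) (p : ℕ × ℕ) :
    (number ^ k) f p = ((p.1 + p.2 : ℕ) : ℂ) ^ k * f p := by
  induction k with
  | zero => simp
  | succ k ih => rw [pow_succ', Module.End.mul_apply, number_apply, ih, pow_succ', mul_assoc]

theorem memℓp_two_iff {f : Amp} : Memℓp f 2 ↔ Summable fun p => ‖f p‖ ^ 2 := by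
  rw [memℓp_gen_iff (by simp)]
  simp

/-- The rapidly decreasing vectors as a space. -/
def smoothSub : Submodule ℂ Amp where
  carrier := {f | IsSmooth f}
  zero_mem' k := by rw [map_zero]; exact zero_memℓp
  add_mem' hf hg k := by rw [map_add]; exact (hf k).add (hg k)
  smul_mem' c f hf k := by rw [map_smul]; exact (hf k).const_smul c

theorem IsSmooth.memℓp {f : Amp} (hf : IsSmooth f) : Memℓp f 2 := hf 0

theorem isSmooth_number {f : Amp} (hf : IsSmooth f) : IsSmooth (number f) := fun k => by
  rw [← Module.End.mul_apply, ← pow_succ]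
  exact hf (k + 1)

theorem isSmooth_number_add_one_pow {f : Amp} (hf : IsSmooth f) (k : ℕ) :
    IsSmooth (((number + 1) ^ k) f) := by
  induction k with
  | zero => simpa using hf
  | succ k ih =>
    rw [pow_succ', Module.End.mul_apply, LinearMap.add_apply, Module.End.one_apply]
    exact smoothSub.add_mem (isSmooth_number ih) ih

theorem number_add_one_pow_apply (k : ℕ) (f : Amp) (p : ℕ × ℕ) :
    ((number + 1) ^ k) f p = ((p.1 + p.2 + 1 : ℕ) : ℂ) ^ k * f p := by
  induction k with
  | zero => simp
  | succ k ih =>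
    rw [pow_succ', Module.End.mul_apply, LinearMap.add_apply, Module.End.one_apply, Pi.add_apply,
      number_apply, ih]
    push_cast
    ring

theorem IsFinite.isSmooth {f : Amp} (hf : IsFinite f) : IsSmooth f := fun k =>
  IsFinite.memℓp (hf.subset fun p hp h => hp (by simp [number_pow_apply, h]))

theorem summable_shift {c : ℕ × ℕ → ℂ} {s : ℕ × ℕ → ℕ × ℕ} (hs : Set.InjOn s {p | c p ≠ 0})
    (hc : ∀ p, ‖c p‖ ≤ 1) (g : Fock) :
    Summable (fun p => ‖c p * g (s p)‖ ^ 2) ∧ ∑' p, ‖c p * g (s p)‖ ^ 2 ≤ ‖g‖ ^ 2 := by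
  have hb : ∀ u : Finset (ℕ × ℕ), ∑ p ∈ u, ‖c p * g (s p)‖ ^ 2 ≤ ‖g‖ ^ 2 := fun u => by
    classical
    calc ∑ p ∈ u, ‖c p * g (s p)‖ ^ 2 = ∑ p ∈ u with c p ≠ 0, ‖c p * g (s p)‖ ^ 2 := by
          rw [Finset.sum_filter]
          refine Finset.sum_congr rfl fun p _ => ?_
          by_cases h : c p = 0 <;> simp [h]
      _ ≤ ∑ p ∈ u with c p ≠ 0, ‖g (s p)‖ ^ 2 := by
          refine Finset.sum_le_sum fun p _ => ?_
          rw [norm_mul]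
          gcongr
          exact mul_le_of_le_one_left (norm_nonneg _) (hc p)
      _ = ∑ q ∈ (u.filter fun p => c p ≠ 0).image s, ‖g q‖ ^ 2 := by
          rw [Finset.sum_image]
          exact hs.mono fun p hp => (Finset.mem_filter.1 hp).2
      _ ≤ ‖g‖ ^ 2 := sum_le_hasSum _ (fun _ _ => by positivity) (hasSum_norm_sq g)
  have h := summable_of_sum_le (fun _ => by positivity) hb
  exact ⟨h, h.tsum_le_of_sum_le hb⟩

/-- The contraction `g ↦ (p ↦ c p * g (s p))` of the Fock space, for `|c| ≤ 1` and a map `s` that is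
injective where `c` does not vanish. -/
noncomputable def weightedShift (c : ℕ × ℕ → ℂ) (s : ℕ × ℕ → ℕ × ℕ)
    (hs : Set.InjOn s {p | c p ≠ 0}) (hc : ∀ p, ‖c p‖ ≤ 1) : Fock →L[ℂ] Fock :=
  LinearMap.mkContinuous
    { toFun := fun g => ⟨fun p => c p * g (s p), memℓp_two_iff.2 (summable_shift hs hc g).1⟩
      map_add' := fun g g' => lp.ext (funext fun p => mul_add (c p) (g (s p)) (g' (s p)))
      map_smul' := fun a g => lp.ext (funext fun p => mul_left_comm (c p) a (g (s p))) } 1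
    fun g => by
      rw [one_mul]
      refine (sq_le_sq₀ (norm_nonneg _) (norm_nonneg _)).1 ?_
      refine le_trans (le_of_eq ?_) (summable_shift hs hc g).2
      have h := lp.norm_rpow_eq_tsum (p := 2) (by simp)
        (⟨fun p => c p * g (s p), memℓp_two_iff.2 (summable_shift hs hc g).1⟩ : Fock)
      simpa using h

theorem weightedShift_apply (c : ℕ × ℕ → ℂ) (s : ℕ × ℕ → ℕ × ℕ)
    (hs : Set.InjOn s {p | c p ≠ 0}) (hc : ∀ p, ‖c p‖ ≤ 1) (g : Fock) (p : ℕ × ℕ) :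
    weightedShift c s hs hc g p = c p * g (s p) := rfl

/-- The matrix elements of the ladder operators: `(𝕆_j f) p` is `ladderCoeff j p` times the
amplitude of `f` at `ladderShift j p`. -/
noncomputable def ladderCoeff (j : Fin 4) (p : ℕ × ℕ) : ℝ :=
  ![√((p.1 : ℝ) + 1), √(p.1 : ℝ), √((p.2 : ℝ) + 1), √(p.2 : ℝ)] j

/-- The index at which `(𝕆_j f) p` evaluates `f`. -/
def ladderShift (j : Fin 4) (p : ℕ × ℕ) : ℕ × ℕ :=
  ![(p.1 + 1, p.2), (p.1 - 1, p.2), (p.1, p.2 + 1), (p.1, p.2 - 1)] j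

theorem ladder_apply (j : Fin 4) (f : Amp) (p : ℕ × ℕ) :
    ladder j f p = ladderCoeff j p * f (ladderShift j p) := by
  fin_cases j <;> rfl

theorem injOn_ladderShift (j : Fin 4) :
    Set.InjOn (ladderShift j) {p | ladderCoeff j p ≠ 0} := by
  rintro ⟨m, n⟩ hp ⟨m', n'⟩ hq h
  have hm : ∀ m : ℕ, √(m : ℝ) ≠ 0 → m ≠ 0 := fun m h h0 => h (by simp [h0])
  fin_cases j <;> simp [ladderShift, ladderCoeff] at h hp hq ⊢ <;> omega

theorem le_ladderShift_add_one (j : Fin 4) (p : ℕ × ℕ) :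
    p.1 + p.2 ≤ (ladderShift j p).1 + (ladderShift j p).2 + 1 := by
  fin_cases j <;> simp [ladderShift] <;> omega

theorem norm_ladderCoeff_le (j : Fin 4) (p : ℕ × ℕ) :
    ‖ladderCoeff j p‖ ≤ (((ladderShift j p).1 + (ladderShift j p).2 + 1 : ℕ) : ℝ) := by
  have h : ∀ m k : ℕ, m ≤ k → √(m : ℝ) ≤ k := fun m k hk => by
    refine (Real.sqrt_le_left (by positivity)).2 ?_
    have h1 : (m : ℝ) ≤ k := by exact_mod_cast hk
    rcases Nat.eq_zero_or_pos k with h0 | h0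
    · simp_all
    · have h2 : (1 : ℝ) ≤ k := by exact_mod_cast h0
      nlinarith
  have h0 : 0 ≤ ladderCoeff j p := by
    fin_cases j <;> simp [ladderCoeff]
  rw [Real.norm_of_nonneg h0]
  obtain ⟨m, n⟩ := p
  fin_cases j
  · simpa [ladderCoeff, ladderShift] using h (m + 1) (m + 1 + n + 1) (by omega)
  · simpa [ladderCoeff, ladderShift] using h m (m - 1 + n + 1) (by omega)
  · simpa [ladderCoeff, ladderShift] using h (n + 1) (m + (n + 1) + 1) (by omega)
  · simpa [ladderCoeff, ladderShift] using h n (m + (n - 1) + 1) (by omega)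

theorem isSmooth_ladder (j : Fin 4) {f : Amp} (hf : IsSmooth f) : IsSmooth (ladder j f) := by
  intro k
  have hg := (isSmooth_number_add_one_pow hf (k + 1)).memℓp
  set N : ℕ × ℕ → ℂ := fun q => ((q.1 + q.2 + 1 : ℕ) : ℂ) with hN
  have hN0 : ∀ q, N q ≠ 0 := fun q => by
    simp only [hN]
    exact_mod_cast Nat.succ_ne_zero (q.1 + q.2)
  have hNn : ∀ q, ‖N q‖ = ((q.1 + q.2 + 1 : ℕ) : ℝ) := fun q => Complex.norm_natCast _
  -- `number ^ k * 𝕆_j` is a bounded weighted shift after `(number + 1) ^ (k + 1)`, since `𝕆_j`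
  -- raises the number of quanta by at most one and its coefficients are at most the initial number
  -- of quanta plus one.
  set c : ℕ × ℕ → ℂ := fun p =>
    ((p.1 + p.2 : ℕ) : ℂ) ^ k * ladderCoeff j p / N (ladderShift j p) ^ (k + 1) with hc
  have hs : Set.InjOn (ladderShift j) {p | c p ≠ 0} :=
    (injOn_ladderShift j).mono fun p (hp : c p ≠ 0) =>
      show ladderCoeff j p ≠ 0 from fun h => hp (by simp [hc, h])
  have hc1 : ∀ p, ‖c p‖ ≤ 1 := fun p => by
    have h1 := norm_ladderCoeff_le j p
    have h2 : ((p.1 + p.2 : ℕ) : ℝ) ≤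
      (((ladderShift j p).1 + (ladderShift j p).2 + 1 : ℕ) : ℝ) := by
      exact_mod_cast le_ladderShift_add_one j p
    simp only [hc, norm_div, norm_mul, norm_pow, Complex.norm_natCast, Complex.norm_real, hNn]
    refine div_le_one_of_le₀ ?_ (by positivity)
    rw [pow_succ]
    gcongr
  have h := lp.memℓp (weightedShift c _ hs hc1 (toFock (((number + 1) ^ (k + 1)) f)))
  convert h using 1
  funext p
  rw [weightedShift_apply, toFock_coe hg, number_pow_apply, ladder_apply,
    number_add_one_pow_apply]
  simp only [hc]
  have := pow_ne_zero (k + 1) (hN0 (ladderShift j p))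
  change _ = _ / _ * (N (ladderShift j p) ^ (k + 1) * _)
  field_simp

theorem isSmooth_ladderDag (j : Fin 4) {f : Amp} (hf : IsSmooth f) :
    IsSmooth (ladderDag j f) := by
  fin_cases j
  exacts [isSmooth_ladder 1 hf, isSmooth_ladder 0 hf, isSmooth_ladder 3 hf, isSmooth_ladder 2 hf]

/-- The ladder operators are bounded relative to the number operator. -/
theorem exists_ladder_eq (j : Fin 4) : ∃ B : Fock →L[ℂ] Fock, ∀ f : Amp, IsSmooth f →
    toFock (ladder j f) = B (toFock (number f) + toFock f) := by
  set N : ℕ × ℕ → ℂ := fun q => ((q.1 + q.2 + 1 : ℕ) : ℂ) with hN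
  have hN0 : ∀ q, N q ≠ 0 := fun q => by
    simp only [hN]
    exact_mod_cast Nat.succ_ne_zero (q.1 + q.2)
  set c : ℕ × ℕ → ℂ := fun p => ladderCoeff j p / N (ladderShift j p) with hc
  have hs : Set.InjOn (ladderShift j) {p | c p ≠ 0} :=
    (injOn_ladderShift j).mono fun p (hp : c p ≠ 0) =>
      show ladderCoeff j p ≠ 0 from fun h => hp (by simp [hc, h])
  have hc1 : ∀ p, ‖c p‖ ≤ 1 := fun p => by
    simp only [hc, norm_div, Complex.norm_real, hN, Complex.norm_natCast]
    exact div_le_one_of_le₀ (norm_ladderCoeff_le j p) (by positivity)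
  refine ⟨weightedShift c _ hs hc1, fun f hf => lp.ext (funext fun p => ?_)⟩
  rw [weightedShift_apply, ← toFock_add (isSmooth_number hf).memℓp hf.memℓp,
    toFock_coe ((isSmooth_number hf).memℓp.add hf.memℓp), toFock_coe (isSmooth_ladder j hf).memℓp,
    ladder_apply, Pi.add_apply, number_apply]
  have h := hN0 (ladderShift j p)
  have e : N (ladderShift j p) = (((ladderShift j p).1 + (ladderShift j p).2 : ℕ) : ℂ) + 1 := by
    simp [hN]
  simp only [hc]
  rw [← add_one_mul, ← e]
  field_simp

/-! ### Quadratic Hamiltonians -/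

theorem quadHam_apply (h : Matrix (Fin 4) (Fin 4) ℂ) (f : Amp) :
    quadHam h f = ∑ j, ∑ k, h j k • ladderDag j (ladder k f) := by
  simp [quadHam, LinearMap.sum_apply]

theorem isSmooth_quadHam (h : Matrix (Fin 4) (Fin 4) ℂ) {f : Amp} (hf : IsSmooth f) :
    IsSmooth (quadHam h f) := by
  rw [quadHam_apply]
  exact smoothSub.sum_mem fun j _ => smoothSub.sum_mem fun k _ =>
    smoothSub.smul_mem _ (isSmooth_ladderDag j (isSmooth_ladder k hf))

theorem toFock_quadHam (h : Matrix (Fin 4) (Fin 4) ℂ) {f : Amp} (hf : IsSmooth f) :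
    toFock (quadHam h f) = ∑ j, ∑ k, h j k • toFock (ladderDag j (ladder k f)) := by
  have hs : ∀ j k, IsSmooth (ladderDag j (ladder k f)) := fun j k =>
    isSmooth_ladderDag j (isSmooth_ladder k hf)
  have h1 := toFock_sum (f := fun j => ∑ k, h j k • ladderDag j (ladder k f))
    (fun j => IsSmooth.memℓp
      (smoothSub.sum_mem fun k _ => smoothSub.smul_mem (h j k) (hs j k))) fun _ => 1
  simp only [one_smul] at h1
  rw [quadHam_apply, h1]
  exact Finset.sum_congr rfl fun j _ => toFock_sum (fun k => (hs j k).memℓp) _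

/-- A quadratic Hamiltonian with Hermitian coefficients is symmetric on the rapidly decreasing
vectors. -/
theorem inner_quadHam {h : Matrix (Fin 4) (Fin 4) ℂ} (hh : h.IsHermitian) {f g : Amp}
    (hf : IsSmooth f) (hg : IsSmooth g) :
    (inner ℂ (toFock f) (toFock (quadHam h g)) : ℂ) =
      inner ℂ (toFock (quadHam h f)) (toFock g) := by
  have h1 : ∀ j {x y : Amp}, IsSmooth x → IsSmooth y →
      (inner ℂ (toFock (ladderDag j x)) (toFock y) : ℂ) =
        inner ℂ (toFock x) (toFock (ladder j y)) := fun j x y hx hy =>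
    inner_ladderDag j hx.memℓp hy.memℓp (isSmooth_ladderDag j hx).memℓp
      (isSmooth_ladder j hy).memℓp
  have h2 : ∀ j {x y : Amp}, IsSmooth x → IsSmooth y →
      (inner ℂ (toFock y) (toFock (ladderDag j x)) : ℂ) =
        inner ℂ (toFock (ladder j y)) (toFock x) := fun j x y hx hy => by
    rw [← inner_conj_symm, h1 j hx hy, inner_conj_symm]
  rw [toFock_quadHam h hf, toFock_quadHam h hg]
  simp only [inner_sum, sum_inner, inner_smul_left, inner_smul_right]
  rw [Finset.sum_comm]
  refine Finset.sum_congr rfl fun k _ => Finset.sum_congr rfl fun j _ => ?_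
  rw [h1 k (isSmooth_ladder j hf) hg, h2 j (isSmooth_ladder k hg) hf, ← hh.apply j k]
  rfl

theorem inner_quadHam_add_inner {h : Matrix (Fin 4) (Fin 4) ℂ} (hh : h.IsHermitian) {f : Amp}
    (hf : IsSmooth f) :
    (inner ℂ (toFock f) (toFock (-Complex.I • quadHam h f)) : ℂ) +
      inner ℂ (toFock (-Complex.I • quadHam h f)) (toFock f) = 0 := by
  rw [toFock_smul _ (isSmooth_quadHam h hf).memℓp, inner_smul_left, inner_smul_right,
    inner_quadHam hh hf hf]
  simp

/-- The coefficients of the Heisenberg equations lie in the symplectic Lie algebra, as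
`[H, [𝕆_j, 𝕆_k]] = 0`. -/
theorem commMat_heisenberg {H : Module.End ℂ Amp} {C : Matrix (Fin 4) (Fin 4) ℂ}
    (hC : ∀ j, Complex.I • (H * ladder j - ladder j * H) = ∑ k, C j k • ladder k) :
    C * commMat + commMat * Cᵀ = 0 := by
  ext j k
  have h1 : (∑ l, C j l • ladder l) * ladder k - ladder k * (∑ l, C j l • ladder l) =
      (C * commMat) j k • 1 := by
    rw [Finset.sum_mul, Finset.mul_sum, ← Finset.sum_sub_distrib, Matrix.mul_apply,
      Finset.sum_smul]
    refine Finset.sum_congr rfl fun l _ => ?_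
    rw [smul_mul_assoc, mul_smul_comm]
    exact (smul_sub (C j l) _ _).symm.trans (by rw [ladder_comm, smul_smul])
  have h2 : ladder j * (∑ l, C k l • ladder l) - (∑ l, C k l • ladder l) * ladder j =
      (commMat * Cᵀ) j k • 1 := by
    rw [Finset.sum_mul, Finset.mul_sum, ← Finset.sum_sub_distrib, Matrix.mul_apply,
      Finset.sum_smul]
    refine Finset.sum_congr rfl fun l _ => ?_
    rw [smul_mul_assoc, mul_smul_comm, Matrix.transpose_apply, mul_comm]
    exact (smul_sub (C k l) _ _).symm.trans (by rw [ladder_comm, smul_smul])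
  have h3 : ((C * commMat + commMat * Cᵀ) j k • 1 : Module.End ℂ Amp) = 0 := by
    have h4 : H * (ladder j * ladder k - ladder k * ladder j) -
        (ladder j * ladder k - ladder k * ladder j) * H = 0 := by
      rw [ladder_comm]; simp
    rw [Matrix.add_apply, add_smul, ← h1, ← h2, ← hC, ← hC]
    rw [← smul_zero Complex.I, ← h4]
    simp only [smul_mul_assoc, mul_smul_comm, mul_sub, sub_mul, smul_sub, mul_assoc]
    abel
  exact (smul_eq_zero.1 h3).resolve_right one_ne_zero

/-! ### The Heisenberg equations -/

/-- Commuting `-i H` through the combination `∑ c_k 𝕆_k` with the Heisenberg equations. -/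
theorem heisenberg_combination {H : Module.End ℂ Amp} {C : Matrix (Fin 4) (Fin 4) ℂ}
    (hC : ∀ j, Complex.I • (H * ladder j - ladder j * H) = ∑ k, C j k • ladder k)
    (c : Fin 4 → ℂ) (g w : Amp) :
    -Complex.I • H (∑ k, c k • ladder k g - w) =
      ∑ k, c k • ladder k (-Complex.I • H g) + ∑ k, (-(c ᵥ* C) k) • ladder k g -
        -Complex.I • H w := by
  have hk : ∀ k, ladder k (-Complex.I • H g) =
      -Complex.I • H (ladder k g) + ∑ l, C k l • ladder l g := fun k => by
    have h := LinearMap.congr_fun (hC k) g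
    simp only [LinearMap.smul_apply, LinearMap.sub_apply, Module.End.mul_apply,
      LinearMap.sum_apply] at h
    rw [← h, map_smul]
    module
  have hc : ∑ k, c k • ∑ l, C k l • ladder l g = ∑ k, (c ᵥ* C) k • ladder k g := by
    simp only [Finset.smul_sum, smul_smul, Matrix.vecMul, dotProduct, Finset.sum_smul]
    rw [Finset.sum_comm]
  have hs : ∑ k, c k • (-Complex.I • H (ladder k g)) =
      -Complex.I • H (∑ k, c k • ladder k g) := by
    rw [map_sum, Finset.smul_sum]
    exact Finset.sum_congr rfl fun k _ => by rw [map_smul, smul_comm]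
  simp only [hk, smul_add, Finset.sum_add_distrib, hc, hs]
  rw [map_sub, smul_sub, ← add_zero (-Complex.I • H (∑ k, c k • ladder k g)), add_assoc, add_assoc,
    zero_add, ← Finset.sum_add_distrib]
  simp

theorem eq_of_hasDerivWithinAt_zero {E : Type*} [NormedAddCommGroup E] [NormedSpace ℝ E]
    {f : ℝ → E} (hf : ∀ t, 0 ≤ t → HasDerivWithinAt f 0 (Set.Ici 0) t) {t : ℝ} (ht : 0 ≤ t) :
    f t = f 0 := by
  refine (convex_Ici (0 : ℝ)).is_const_of_fderivWithin_eq_zero (𝕜 := ℝ)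
    (fun s hs => (hf s hs).differentiableWithinAt) (fun s hs => ?_) ht Set.self_mem_Ici
  rw [(hf s hs).hasFDerivWithinAt.fderivWithin (uniqueDiffOn_Ici 0 s hs)]
  ext
  simp

/-- The inverse `-J Tᵀ J` of a matrix `T` with `Tᵀ J T = J`, where `J` is the matrix of the
commutators. -/
noncomputable def symplInv (T : Matrix (Fin 4) (Fin 4) ℂ) : Matrix (Fin 4) (Fin 4) ℂ :=
  -(commMat * Tᵀ * commMat)

theorem hasDerivWithinAt_symplInv {T : ℝ → Matrix (Fin 4) (Fin 4) ℂ}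
    {C : Matrix (Fin 4) (Fin 4) ℂ} {s : Set ℝ} {t : ℝ} (hC : C * commMat + commMat * Cᵀ = 0)
    (hT : ∀ j k, HasDerivWithinAt (fun r => T r j k) ((C * T t) j k) s t) (j k : Fin 4) :
    HasDerivWithinAt (fun r => symplInv (T r) j k) (-(symplInv (T t) * C) j k) s t := by
  have h1 : -(symplInv (T t) * C) = -(commMat * (C * T t)ᵀ * commMat) := by
    have h2 : Cᵀ * commMat = -(commMat * C) := by
      have h3 : commMat * (C * commMat + commMat * Cᵀ) * commMat = 0 := by simp [hC]
      have h4 : commMat * (C * commMat + commMat * Cᵀ) * commMat =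
          commMat * C * (commMat * commMat) + commMat * commMat * (Cᵀ * commMat) := by
        noncomm_ring
      rw [h4, commMat_mul_self] at h3
      simp only [mul_neg, mul_one, neg_mul, one_mul] at h3
      rw [← sub_eq_zero, ← neg_eq_zero, ← h3]
      abel
    rw [symplInv, Matrix.transpose_mul]
    simp only [Matrix.mul_assoc, h2]
    simp [Matrix.mul_assoc]
  have h5 : HasDerivWithinAt (fun r => -(∑ l, (∑ m, commMat j m * T r l m) * commMat l k))
      (-(∑ l, (∑ m, commMat j m * (C * T t) l m) * commMat l k)) s t :=
    (HasDerivWithinAt.fun_sum fun l _ => (HasDerivWithinAt.fun_sum fun m _ =>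
      (hT l m).const_mul (commMat j m)).mul_const (commMat l k)).neg
  rw [← Matrix.neg_apply, h1]
  exact h5

/-- The product `S T` is constant, as `S' T + S T' = -S C T + S C T = 0`. -/
theorem symplInv_mul_self {h T : ℝ → Matrix (Fin 4) (Fin 4) ℂ} (hT : SolvesHeisenberg h T) {t : ℝ}
    (ht : 0 ≤ t) : symplInv (T t) * T t = 1 := by
  have h0 : symplInv (T 0) * T 0 = 1 := by
    rw [hT.1, symplInv]
    simp [commMat_mul_self]
  rw [← h0]
  ext j k
  refine eq_of_hasDerivWithinAt_zero (f := fun s => (symplInv (T s) * T s) j k)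
    (fun s hs => ?_) ht
  obtain ⟨C, hC, hd⟩ := hT.2 s hs
  have h1 := hasDerivWithinAt_symplInv (commMat_heisenberg hC) hd
  have h2 : HasDerivWithinAt (fun r => ∑ l, symplInv (T r) j l * T r l k)
      (∑ l, (-(symplInv (T s) * C) j l * T s l k + symplInv (T s) j l * (C * T s) l k))
      (Set.Ici 0) s := HasDerivWithinAt.fun_sum fun l _ => (h1 j l).mul (hd l k)
  have h3 : ∑ l, (-(symplInv (T s) * C) j l * T s l k +
      symplInv (T s) j l * (C * T s) l k) = 0 := by
    have h4 := Matrix.mul_apply (M := symplInv (T s) * C) (N := T s) (i := j) (k := k)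
    have h5 := Matrix.mul_apply (M := symplInv (T s)) (N := C * T s) (i := j) (k := k)
    rw [Finset.sum_add_distrib]
    simp only [neg_mul, Finset.sum_neg_distrib]
    rw [← h4, ← h5, mul_assoc, neg_add_cancel]
  rw [h3] at h2
  exact h2

theorem hasDerivWithinAt_ladder {h : ℝ → Matrix (Fin 4) (Fin 4) ℂ} {U : ℝ → Fock →L[ℂ] Fock}
    (hU : IsEvolution h U) (j : Fin 4) {ψ : Fock} (hψ : IsSmooth ψ) {t : ℝ} (ht : 0 ≤ t) :
    HasDerivWithinAt (fun s => toFock (ladder j (U s ψ)))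
      (toFock (ladder j (-Complex.I • quadHam (h t) (U t ψ)))) (Set.Ici 0) t := by
  obtain ⟨B, hB⟩ := exists_ladder_eq j
  have h1 := (hU.schrodinger t ht ψ hψ 1).add (hU.schrodinger t ht ψ hψ 0)
  simp only [pow_one, pow_zero, Module.End.one_apply] at h1
  have h2 := (B.restrictScalars ℝ).hasFDerivAt.comp_hasDerivWithinAt t h1
  have h3 : IsSmooth (-Complex.I • quadHam (h t) (U t ψ)) :=
    smoothSub.smul_mem _ (isSmooth_quadHam _ (hU.smooth t ht ψ hψ))
  rw [hB _ h3]
  exact h2.congr (fun s hs => hB _ (hU.smooth s hs ψ hψ)) (hB _ (hU.smooth t ht ψ hψ))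

/-- The vectors `∑ S_jk 𝕆_k U(t)ψ` with `S = T⁻¹` solve the same Schrödinger equation as
`U(t) 𝕆_j ψ`, with the same initial value, so the norm of their difference is constant. -/
theorem sum_symplInv_ladder {h T : ℝ → Matrix (Fin 4) (Fin 4) ℂ} {U : ℝ → Fock →L[ℂ] Fock}
    (hh : ∀ t, 0 ≤ t → (h t).IsHermitian) (hU : IsEvolution h U) (hT : SolvesHeisenberg h T)
    {f : Amp} (hf : IsFinite f) (j : Fin 4) {t : ℝ} (ht : 0 ≤ t) :
    ∑ k, symplInv (T t) j k • ladder k (U t (toFock f)) =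
      (U t (toFock (ladder j f)) : Amp) := by
  have hψ : IsSmooth (toFock f) := by rw [toFock_coe hf.memℓp]; exact hf.isSmooth
  have hχ : IsSmooth (toFock (ladder j f)) := by
    rw [toFock_coe (isFinite_ladder j hf).memℓp]
    exact (isFinite_ladder j hf).isSmooth
  set E : ℝ → Amp := fun s => ∑ k, symplInv (T s) j k • ladder k (U s (toFock f)) -
    (U s (toFock (ladder j f)) : Amp) with hE
  have hl : ∀ s, 0 ≤ s → ∀ k, IsSmooth (ladder k (U s (toFock f))) := fun s hs k =>
    isSmooth_ladder k (hU.smooth s hs _ hψ)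
  have hEs : ∀ s, 0 ≤ s → IsSmooth (E s) := fun s hs => smoothSub.sub_mem
    (smoothSub.sum_mem fun k _ => smoothSub.smul_mem _ (hl s hs k)) (hU.smooth s hs _ hχ)
  have hFock : ∀ s, 0 ≤ s → toFock (E s) =
      ∑ k, symplInv (T s) j k • toFock (ladder k (U s (toFock f))) -
        U s (toFock (ladder j f)) := fun s hs => by
    refine lp.ext ?_
    rw [toFock_coe (hEs s hs).memℓp, lp.coeFn_sub, ← toFock_sum fun k => (hl s hs k).memℓp,
      toFock_coe]
    exact IsSmooth.memℓp (smoothSub.sum_mem fun k _ => smoothSub.smul_mem _ (hl s hs k))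
  have hd : ∀ s, 0 ≤ s → HasDerivWithinAt (fun r => toFock (E r))
      (toFock (-Complex.I • quadHam (h s) (E s))) (Set.Ici 0) s := fun s hs => by
    obtain ⟨C, hC, hdT⟩ := hT.2 s hs
    set g : Amp := (U s (toFock f)).1 with hg
    set w : Amp := (U s (toFock (ladder j f))).1 with hw
    have hgs : IsSmooth g := hU.smooth s hs _ hψ
    have hws : IsSmooth w := hU.smooth s hs _ hχ
    have h1 := hasDerivWithinAt_symplInv (commMat_heisenberg hC) hdT j
    have h2 := hU.schrodinger s hs _ hχ 0
    simp only [pow_zero, Module.End.one_apply, toFock_self] at h2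
    have h3 := (HasDerivWithinAt.fun_sum (u := Finset.univ) fun k _ =>
      (h1 k).smul (hasDerivWithinAt_ladder hU k hψ hs)).sub h2
    have hm1 : ∀ k, IsSmooth (ladder k (-Complex.I • quadHam (h s) g)) := fun k =>
      isSmooth_ladder k (smoothSub.smul_mem _ (isSmooth_quadHam _ hgs))
    have hm2 : IsSmooth (-Complex.I • quadHam (h s) w) :=
      smoothSub.smul_mem _ (isSmooth_quadHam _ hws)
    -- The derivatives of the coefficients `S_jk` cancel the Heisenberg terms.
    have hamp : -Complex.I • quadHam (h s) (E s) =
        ∑ k, symplInv (T s) j k • ladder k (-Complex.I • quadHam (h s) g) +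
          ∑ k, (-(symplInv (T s) * C) j k) • ladder k g +
            (-1 : ℂ) • (-Complex.I • quadHam (h s) w) := by
      rw [neg_one_smul, ← sub_eq_add_neg]
      exact heisenberg_combination hC (fun k => symplInv (T s) j k) g w
    have hval : toFock (-Complex.I • quadHam (h s) (E s)) =
        ∑ k, (symplInv (T s) j k • toFock (ladder k (-Complex.I • quadHam (h s) g)) +
          (-(symplInv (T s) * C) j k) • toFock (ladder k g)) -
          toFock (-Complex.I • quadHam (h s) w) := by
      have hs1 : IsSmooth (∑ k, symplInv (T s) j k • ladder k (-Complex.I • quadHam (h s) g)) :=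
        smoothSub.sum_mem fun k _ => smoothSub.smul_mem _ (hm1 k)
      have hs2 : IsSmooth (∑ k, (-(symplInv (T s) * C) j k) • ladder k g) :=
        smoothSub.sum_mem fun k _ => smoothSub.smul_mem _ (isSmooth_ladder k hgs)
      rw [hamp, toFock_add (hs1.memℓp.add hs2.memℓp) (hm2.memℓp.const_smul _),
        toFock_add hs1.memℓp hs2.memℓp, toFock_smul _ hm2.memℓp,
        toFock_sum fun k => (hm1 k).memℓp, toFock_sum fun k => (isSmooth_ladder k hgs).memℓp,
        Finset.sum_add_distrib, neg_one_smul, sub_eq_add_neg]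
    rw [hval]
    exact h3.congr (fun r hr => hFock r hr) (hFock s hs)
  have hc := eq_of_hasDerivWithinAt_zero (f := fun s => (inner ℂ (toFock (E s)) (toFock (E s)) : ℂ))
    (fun s hs => by
      have h1 := (hd s hs).inner ℂ (hd s hs)
      rwa [inner_quadHam_add_inner (hh s hs) (hEs s hs)] at h1) ht
  have hE0 : E 0 = 0 := by
    have hS : symplInv (T 0) = 1 := by
      rw [hT.1, symplInv]
      simp [commMat_mul_self]
    simp only [hE, hS, hU.init, one_apply_eq_self, Matrix.one_apply, ite_smul, one_smul, zero_smul,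
      Finset.sum_ite_eq, Finset.mem_univ, if_true]
    rw [toFock_coe hf.memℓp, toFock_coe (isFinite_ladder j hf).memℓp, sub_self]
  have h0 : toFock (0 : Amp) = 0 := lp.ext (toFock_coe zero_memℓp)
  simp only [hE0, h0, inner_zero_left, inner_self_eq_zero] at hc
  have h1 := toFock_coe (hEs t ht).memℓp
  rw [hc] at h1
  exact sub_eq_zero.1 h1.symm

theorem IsEvolution.actsLinearly {h T : ℝ → Matrix (Fin 4) (Fin 4) ℂ} {U : ℝ → Fock →L[ℂ] Fock}
    (hh : ∀ t, 0 ≤ t → (h t).IsHermitian) (hU : IsEvolution h U) (hT : SolvesHeisenberg h T)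
    {t : ℝ} (ht : 0 ≤ t) : ActsLinearly (U t) (T t) := by
  intro f hf i
  have h1 := fun j => sum_symplInv_ladder hh hU hT hf j ht
  have h2 : T t * symplInv (T t) = 1 := mul_eq_one_comm.1 (symplInv_mul_self hT ht)
  rw [toFock_sum fun k => (isFinite_ladder k hf).memℓp, map_sum, lp.coeFn_sum]
  simp only [map_smul, lp.coeFn_smul, ← h1]
  simp only [Finset.smul_sum, smul_smul]
  rw [Finset.sum_comm]
  simp only [← Finset.sum_smul]
  have h3 : ∀ k, ∑ j, T t i j * symplInv (T t) j k = (1 : Matrix (Fin 4) (Fin 4) ℂ) i k :=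
    fun k => by rw [← h2, Matrix.mul_apply]
  simp [h3, Matrix.one_apply]

end TwoMode

theorem mainTheorem3
    (U : ℝ → unitary (Fock →L[ℂ] Fock))
    (μa νa χa ηa μb νb χb ηb : ℝ → ℂ)
    (T : ℝ → Matrix (Fin 4) (Fin 4) ℂ)
    (hT : ∀ t, T t = dynMatrix (μa t) (νa t) (χa t) (ηa t) (μb t) (νb t) (χb t) (ηb t)) :
    -- a quadratic Hamiltonian acts linearly, through the solution of the Heisenberg equations
    (∀ h : ℝ → Matrix (Fin 4) (Fin 4) ℂ, (∀ t, 0 ≤ t → (h t).IsHermitian) →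
      IsEvolution h (fun t => U t) → SolvesHeisenberg h T →
        ∀ t, 0 ≤ t → ActsLinearly (U t) (T t)) ∧
    -- every linear action is an evaluation of the initial Wigner function at `Z = T⁻¹(t) X`
    ((∀ t, 0 ≤ t → ActsLinearly (U t) (T t)) →
      ∀ t, 0 ≤ t → IsUnit (T t) ∧
        (∀ α : ℂ × ℂ, (T t)⁻¹ *ᵥ phaseVec α = phaseVec
          (conj (μa t) * α.1 - νa t * conj α.1 + conj (μb t) * α.2 - νb t * conj α.2,
            conj (χa t) * α.1 - ηa t * conj α.1 + conj (χb t) * α.2 - ηb t * conj α.2)) ∧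
        ∀ ρ : ℝ → Fock →L[ℂ] Fock, IsDensityOperator (ρ 0) →
          (∀ s, 0 ≤ s → ρ s = (U s : Fock →L[ℂ] Fock) * ρ 0 * star (U s : Fock →L[ℂ] Fock)) →
            (MeasureTheory.Integrable (charFun (ρ t)) ↔
              MeasureTheory.Integrable (charFun (ρ 0))) ∧
            (∀ α : ℂ × ℂ, wigner (ρ t) (phaseVec α) = wigner (ρ 0) ((T t)⁻¹ *ᵥ phaseVec α)) ∧
            -- the same identity, `∫ W(X;t) f(X) dX = ∫ W(Z;0) f(T(t) Z) dZ`, for states whose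
            -- characteristic function is not integrable
            ∀ f : SchwartzMap (ℂ × ℂ) ℂ, wignerPairing (ρ t) f = wignerPairing (ρ 0)
              (fun γ => f ((T t *ᵥ phaseVec γ) 0, (T t *ᵥ phaseVec γ) 2))) := by
  refine ⟨fun h hh hU hTh t ht => hU.actsLinearly hh hTh ht, fun hU t ht => ?_⟩
  have hUU : star (U t : Fock →L[ℂ] Fock) * U t = 1 := Unitary.star_mul_self_of_mem (U t).2
  have hinj : Function.Injective (U t : Fock →L[ℂ] Fock) := by
    intro ψ χ h
    have h1 := congrArg (star (U t : Fock →L[ℂ] Fock) : Fock →L[ℂ] Fock) h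
    rwa [← mul_apply_eq_comp, ← mul_apply_eq_comp, hUU, one_apply_eq_self,
      one_apply_eq_self] at h1
  have hconj : (T t)ᴴ = conjMat * (T t)ᵀ * conjMat := by
    rw [hT]
    exact conjTranspose_dynMatrix ..
  have hE := mul_signMat_mul_conjTranspose hconj ((hU t ht).mul_commMat hinj)
  have hr : T t * (signMat * (T t)ᴴ * signMat) = 1 := by
    rw [← mul_assoc, ← mul_assoc, hE, signMat_mul_self]
  have hinv : (T t)⁻¹ = signMat * (T t)ᴴ * signMat := Matrix.inv_eq_right_inv hr
  have hE' : (T t)ᴴ * signMat * T t = signMat := by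
    calc (T t)ᴴ * signMat * T t
        = signMat * (signMat * (T t)ᴴ * signMat * T t) := by
          simp only [← mul_assoc, signMat_mul_self, one_mul]
      _ = signMat := by rw [mul_eq_one_comm.1 hr, mul_one]
  have hv : ∀ z, phaseVec (phaseMap (T t) z) = T t *ᵥ phaseVec z := by
    rw [hT]
    exact phaseVec_phaseMap _ _ _ _ _ _ _ _
  refine ⟨IsUnit.of_mul_eq_one _ hr, fun α => ?_, fun ρ hρ hρt => ?_⟩
  · rw [hinv, hT]
    exact inv_dynMatrix_mulVec ..
  · rw [hρt t ht]
    refine ⟨integrable_charFun_conj_iff (hU t ht) hUU hv hE' hρ, fun α => ?_,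
      fun f => wignerPairing_conj (hU t ht) hUU hv hE' hρ f⟩
    rw [← wigner_conj (hU t ht) hUU hv hE' hρ, hinv, Matrix.mulVec_mulVec, hr, Matrix.one_mulVec]
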